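/- Let $\mathcal H=\mathbb C^n$, and let $\{\rho_\theta\}_{\theta\in\Theta}$ be a continuously differentiable family of positive definite density matrices on $\mathcal H$, where $\Theta\subset\mathbb R^{d}$ is open, $d=d_I+d_N$, $\theta=(\theta_I,\theta_N)$, the first $d_I$ coordinates are the parameters of interest and the last $d_N$ the nuisance parameters, and at each $\theta\in\Theta$ the matrices $\partial_1\rho_\theta,\dots,\partial_d\rho_\theta$ are linearly independent over $\mathbb R$. Put $\langle X,Y\rangle^S=\tfrac12\operatorname{tr}\rho_\theta(YX^\dagger+X^\dagger Y)$ and $\langle X,Y\rangle^R=\operatorname{tr}\rho_\theta YX^\dagger$. Let $L^S_j$ (Hermitian) and $L^R_j$ be the solutions of $\partial_j\rho_\theta=\tfrac12(L^S_j\rho_\theta+\rho_\theta L^S_j)$ and $\partial_j\rho_\theta=\rho_\theta L^R_j$. For $\ast\in\{S,R\}$ let $J^\ast_{i,j}=\langle L^\ast_i,L^\ast_j\rangle^\ast$, with nuisance block $J^\ast_{N,N}$, and define the effective SLDs and RLDs by $$\tilde L^\ast_i=L^\ast_i-\sum_{j,k=d_I+1}^{d}J^\ast_{i,j}\,\big((J^\ast_{N,N})^{-1}\big)_{j,k}\,L^\ast_k\qquad(i=1,\dots,d_I).$$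 The partial RLD Fisher information matrix is $J^R_\theta(I|N)=[\langle\tilde L^R_i,\tilde L^R_j\rangle^R]_{i,j\le d_I}$. Below, $\mathrm{Re}$ and $\mathrm{Im}$ of a matrix are taken entrywise and $|A|=\sqrt{A^\dagger A}$. For a real symmetric positive definite $d_I\times d_I$ matrix $W_I$ let $$C^R_{\theta;I}[W_I]=\operatorname{Tr}\,W_I\,\mathrm{Re}\,J^R_\theta(I|N)^{-1}+\operatorname{Tr}\big|W_I^{1/2}\,\mathrm{Im}\,J^R_\theta(I|N)^{-1}\,W_I^{1/2}\big| ,$$ $$C^H_{\theta;I}[W_I]=\min_{X}\Big\{\operatorname{Tr}\,W_I\,\mathrm{Re}\,Z_\theta(X)+\operatorname{Tr}\big|W_I^{1/2}\,\mathrm{Im}\,Z_\theta(X)\,W_I^{1/2}\big|\Big\},\qquad Z_\theta(X)_{i,j}=\operatorname{tr}X_i\rho_\theta X_j ,$$ where $X=(X_1,\dots,X_{d_I})$ runs over the vectors of Hermitian matrices with $\operatorname{tr}(\partial_j\rho_\theta\,X_i)=\delta_{i,j}$ for $1\le i\le d_I$, $1\le j\le d$. The commutation operator $\mathcal D_\rho$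 is defined by $\rho X-X\rho=\mathrm i\,\rho\,\mathcal D_\rho(X)+\mathrm i\,\mathcal D_\rho(X)\,\rho$. The model is called D-invariant for the parameters of interest at $\theta$ if $\mathcal D_{\rho_\theta}(\tilde L^S_i)\in\mathrm{span}_{\mathbb R}\{\tilde L^S_1,\dots,\tilde L^S_{d_I}\}$ for all $i\le d_I$, and D-invariant for the parameters of interest if this holds at every $\theta\in\Theta$. Then the minimum defining $C^H_{\theta;I}[W_I]$ is attained for all $\theta\in\Theta$ and $W_I>0$. For each $\theta\in\Theta$, the model is D-invariant for the parameters of interest at $\theta$ if and only if $C^H_{\theta;I}[W_I]=C^R_{\theta;I}[W_I]$ for every $W_I>0$. In particular, the model is D-invariant for the parameters of interest if and only if $C^H_{\theta;I}[W_I]=C^R_{\theta;I}[W_I]$ for every $\theta\in\Theta$ and every $W_I>0$. -/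

import Mathlib

open scoped MatrixOrder ComplexOrder

namespace QNuisance

/-! ### Operator equations at a full-rank state -/

section Operators

variable {n : ℕ}

theorem anticomm_eq_zero {ρ X : Matrix (Fin n) (Fin n) ℂ} (hρ : ρ.PosDef)
    (h : ρ * X + X * ρ = 0) : X = 0 := by
  have h1 : (X.conjTranspose * ρ * X).PosSemidef :=
    hρ.posSemidef.conjTranspose_mul_mul_same X
  have h2 : (X * ρ * X.conjTranspose).PosSemidef :=
    hρ.posSemidef.mul_mul_conjTranspose_same X
  have h3 : (X.conjTranspose * ρ * X).trace + (X * ρ * X.conjTranspose).trace = 0 := by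
    have : (X.conjTranspose * (ρ * X + X * ρ)).trace = 0 := by simp [h]
    rw [Matrix.mul_add, Matrix.trace_add, ← Matrix.mul_assoc] at this
    rwa [Matrix.trace_mul_comm (X * ρ) X.conjTranspose]
  have h4 : (X.conjTranspose * ρ * X).trace = 0 :=
    ((add_eq_zero_iff_of_nonneg h1.trace_nonneg h2.trace_nonneg).1 h3).1
  have h5 : X.conjTranspose * ρ * X = 0 := h1.trace_eq_zero_iff.1 h4
  ext i j
  have h6 : ∀ v : Fin n → ℂ, X.mulVec v = 0 := by
    intro v
    by_contra hv
    have h7 := hρ.dotProduct_mulVec_pos hv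
    have h8 : star (X.mulVec v) ⬝ᵥ ρ.mulVec (X.mulVec v)
        = star v ⬝ᵥ (X.conjTranspose * ρ * X).mulVec v := by
      simp only [Matrix.star_mulVec, Matrix.dotProduct_mulVec, Matrix.vecMul_vecMul,
        Matrix.mul_assoc]
    rw [h8, h5] at h7
    simp at h7
  have := congrFun (h6 (Pi.single j 1)) i
  simpa using this

/-- For a positive definite `ρ`, the equation `ρ X + X ρ = B` has exactly one solution. -/
theorem existsUnique_anticomm {ρ : Matrix (Fin n) (Fin n) ℂ} (hρ : ρ.PosDef)
    (B : Matrix (Fin n) (Fin n) ℂ) : ∃! X, ρ * X + X * ρ = B := by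
  let f : Matrix (Fin n) (Fin n) ℂ →ₗ[ℂ] Matrix (Fin n) (Fin n) ℂ :=
    LinearMap.mulLeft ℂ ρ + LinearMap.mulRight ℂ ρ
  have hinj : Function.Injective f := by
    rw [← LinearMap.ker_eq_bot, LinearMap.ker_eq_bot']
    intro X hX
    exact anticomm_eq_zero hρ hX
  obtain ⟨X, hX⟩ := (LinearMap.injective_iff_surjective.1 hinj) B
  exact ⟨X, hX, fun Y hY => hinj (hY.trans hX.symm)⟩

open Classical in
/-- The solution `X` of `ρ X + X ρ = B` (unique when `ρ` is positive definite). -/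
noncomputable def anticommSol (ρ B : Matrix (Fin n) (Fin n) ℂ) : Matrix (Fin n) (Fin n) ℂ :=
  if h : ∃ X, ρ * X + X * ρ = B then h.choose else 0

theorem anticommSol_spec {ρ : Matrix (Fin n) (Fin n) ℂ} (hρ : ρ.PosDef)
    (B : Matrix (Fin n) (Fin n) ℂ) :
    ρ * anticommSol ρ B + anticommSol ρ B * ρ = B := by
  have h := (existsUnique_anticomm hρ B).exists
  rw [anticommSol, dif_pos h]
  exact h.choose_spec

/-- The symmetric logarithmic derivative at the state `ρ` for the derivative `A` of the state:
the matrix `L` with `A = (L ρ + ρ L) / 2`. -/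
noncomputable def sldOf (ρ A : Matrix (Fin n) (Fin n) ℂ) : Matrix (Fin n) (Fin n) ℂ :=
  anticommSol ρ ((2 : ℂ) • A)

theorem sldOf_spec {ρ : Matrix (Fin n) (Fin n) ℂ} (hρ : ρ.PosDef)
    (A : Matrix (Fin n) (Fin n) ℂ) :
    A = (1 / 2 : ℂ) • (sldOf ρ A * ρ + ρ * sldOf ρ A) := by
  rw [add_comm, sldOf, anticommSol_spec hρ, smul_smul]
  norm_num

theorem sldOf_isHermitian {ρ A : Matrix (Fin n) (Fin n) ℂ} (hρ : ρ.PosDef)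
    (hA : A.IsHermitian) : (sldOf ρ A).IsHermitian := by
  have h := anticommSol_spec hρ ((2 : ℂ) • A)
  refine (existsUnique_anticomm hρ ((2 : ℂ) • A)).unique ?_ h
  have h' := congrArg Matrix.conjTranspose h
  rw [Matrix.conjTranspose_add, Matrix.conjTranspose_mul, Matrix.conjTranspose_mul,
    Matrix.conjTranspose_smul, hρ.isHermitian.eq, hA.eq, add_comm] at h'
  simpa [sldOf] using h'

/-- The right logarithmic derivative at the state `ρ` for the derivative `A` of the state:
the matrix `L` with `A = ρ L`. -/
noncomputable def rldOf (ρ A : Matrix (Fin n) (Fin n) ℂ) : Matrix (Fin n) (Fin n) ℂ :=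
  ρ⁻¹ * A

theorem rldOf_spec {ρ : Matrix (Fin n) (Fin n) ℂ} (hρ : ρ.PosDef)
    (A : Matrix (Fin n) (Fin n) ℂ) : A = ρ * rldOf ρ A := by
  rw [rldOf, Matrix.mul_nonsing_inv_cancel_left]
  exact (Matrix.isUnit_iff_isUnit_det ρ).1 hρ.isUnit

/-- The commutation operator `𝒟_ρ`. -/
noncomputable def commOp (ρ X : Matrix (Fin n) (Fin n) ℂ) : Matrix (Fin n) (Fin n) ℂ :=
  anticommSol ρ ((-Complex.I) • (ρ * X - X * ρ))

theorem commOp_spec {ρ : Matrix (Fin n) (Fin n) ℂ} (hρ : ρ.PosDef)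
    (X : Matrix (Fin n) (Fin n) ℂ) :
    ρ * X - X * ρ = Complex.I • (ρ * commOp ρ X) + Complex.I • (commOp ρ X * ρ) := by
  rw [← smul_add, commOp, anticommSol_spec hρ, smul_smul]
  simp

/-- The symmetric inner product `⟨X, Y⟩^S = tr (ρ (Y X† + X† Y)) / 2`. -/
noncomputable def sldInner (ρ X Y : Matrix (Fin n) (Fin n) ℂ) : ℂ :=
  (1 / 2) * (ρ * (Y * X.conjTranspose + X.conjTranspose * Y)).trace

/-- The right inner product `⟨X, Y⟩^R = tr (ρ Y X†)`. -/
noncomputable def rldInner (ρ X Y : Matrix (Fin n) (Fin n) ℂ) : ℂ :=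
  (ρ * Y * X.conjTranspose).trace

/-- On Hermitian matrices the symmetric inner product is real. -/
theorem sldInner_im {ρ X Y : Matrix (Fin n) (Fin n) ℂ} (hρ : ρ.IsHermitian)
    (hX : X.IsHermitian) (hY : Y.IsHermitian) : (sldInner ρ X Y).im = 0 := by
  have h : star (sldInner ρ X Y) = sldInner ρ X Y := by
    unfold sldInner
    rw [hX.eq, star_mul', ← Matrix.trace_conjTranspose, Matrix.conjTranspose_mul,
      Matrix.conjTranspose_add, Matrix.conjTranspose_mul, Matrix.conjTranspose_mul,
      hρ.eq, hX.eq, hY.eq, Matrix.trace_mul_comm, add_comm (X * Y)]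
    simp
  exact Complex.conj_eq_iff_im.1 h

end Operators

/-- The partial derivative of a matrix-valued function in the `j`-th coordinate, entrywise. -/
noncomputable def partialDeriv {n : ℕ} {ι : Type} [Fintype ι] [DecidableEq ι]
    (f : (ι → ℝ) → Matrix (Fin n) (Fin n) ℂ) (θ : ι → ℝ) (j : ι) : Matrix (Fin n) (Fin n) ℂ :=
  Matrix.of fun a b => fderiv ℝ (fun η => f η a b) θ (Pi.single j 1)

/-- A regular quantum statistical model on an `n`-dimensional Hilbert space with `dI` parameters
of interest (indices `Sum.inl i`) and `dN` nuisance parameters (indices `Sum.inr k`): a continuously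
differentiable family of full-rank states on an open parameter set, with linearly independent
partial derivatives. The values of `state` outside `Θ` are irrelevant. -/
structure Model (n dI dN : ℕ) where
  Θ : Set (Fin dI ⊕ Fin dN → ℝ)
  isOpen : IsOpen Θ
  state : (Fin dI ⊕ Fin dN → ℝ) → Matrix (Fin n) (Fin n) ℂ
  posDef : ∀ θ ∈ Θ, (state θ).PosDef
  trace_eq_one : ∀ θ ∈ Θ, (state θ).trace = 1
  contDiffOn : ∀ a b, ContDiffOn ℝ 1 (fun θ => state θ a b) Θ
  linearIndependent : ∀ θ ∈ Θ, LinearIndependent ℝ (partialDeriv state θ)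

namespace Model

variable {n dI dN : ℕ} (M : Model n dI dN) (θ : Fin dI ⊕ Fin dN → ℝ)

/-- The partial derivative `∂ρ_θ / ∂θ_j`. -/
noncomputable def dstate (j : Fin dI ⊕ Fin dN) : Matrix (Fin n) (Fin n) ℂ :=
  partialDeriv M.state θ j

/-- The SLD `L^S_{θ;j}`. -/
noncomputable def sld (j : Fin dI ⊕ Fin dN) : Matrix (Fin n) (Fin n) ℂ :=
  sldOf (M.state θ) (M.dstate θ j)

/-- The RLD `L^R_{θ;j}`. -/
noncomputable def rld (j : Fin dI ⊕ Fin dN) : Matrix (Fin n) (Fin n) ℂ :=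
  rldOf (M.state θ) (M.dstate θ j)

/-- The SLD Fisher information matrix; its entries are real since SLDs are Hermitian. -/
noncomputable def sldFisher : Matrix (Fin dI ⊕ Fin dN) (Fin dI ⊕ Fin dN) ℝ :=
  Matrix.of fun i j => (sldInner (M.state θ) (M.sld θ i) (M.sld θ j)).re

/-- The RLD Fisher information matrix. -/
noncomputable def rldFisher : Matrix (Fin dI ⊕ Fin dN) (Fin dI ⊕ Fin dN) ℂ :=
  Matrix.of fun i j => rldInner (M.state θ) (M.rld θ i) (M.rld θ j)

/-- The effective SLDs for the parameters of interest. -/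
noncomputable def effSLD (i : Fin dI) : Matrix (Fin n) (Fin n) ℂ :=
  M.sld θ (Sum.inl i) - ∑ j : Fin dN, ∑ k : Fin dN,
    (M.sldFisher θ (Sum.inl i) (Sum.inr j) * (M.sldFisher θ).toBlocks₂₂⁻¹ j k) •
      M.sld θ (Sum.inr k)

/-- The effective RLDs for the parameters of interest. -/
noncomputable def effRLD (i : Fin dI) : Matrix (Fin n) (Fin n) ℂ :=
  M.rld θ (Sum.inl i) - ∑ j : Fin dN, ∑ k : Fin dN,
    (M.rldFisher θ (Sum.inl i) (Sum.inr j) * (M.rldFisher θ).toBlocks₂₂⁻¹ j k) •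
      M.rld θ (Sum.inr k)

/-- The partial RLD Fisher information matrix `J^R_θ(I|N)`. -/
noncomputable def partialRLDFisher : Matrix (Fin dI) (Fin dI) ℂ :=
  Matrix.of fun i j => rldInner (M.state θ) (M.effRLD θ i) (M.effRLD θ j)

end Model

/-- `Tr (W Re Z) + Tr |W^{1/2} (Im Z) W^{1/2}|`, with entrywise real and imaginary parts
and `|A| = (A† A)^{1/2}`. -/
noncomputable def weightedBound {d : ℕ} (W : Matrix (Fin d) (Fin d) ℝ)
    (Z : Matrix (Fin d) (Fin d) ℂ) : ℝ :=
  (W * Z.map Complex.re).trace +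
    (CFC.abs (CFC.sqrt W * Z.map Complex.im * CFC.sqrt W)).trace

namespace Model

variable {n dI dN : ℕ} (M : Model n dI dN) (θ : Fin dI ⊕ Fin dN → ℝ)

/-- The RLD Cramér–Rao bound for the parameters of interest. -/
noncomputable def rldBound (W : Matrix (Fin dI) (Fin dI) ℝ) : ℝ :=
  weightedBound W (M.partialRLDFisher θ)⁻¹

/-- The vectors of Hermitian matrices over which the Holevo bound is minimized:
`tr (∂_j ρ_θ X_i) = δ_{ij}` for all `i` of interest and all parameters `j`. -/
def Feasible (X : Fin dI → Matrix (Fin n) (Fin n) ℂ) : Prop :=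
  (∀ i, (X i).IsHermitian) ∧
    ∀ (i : Fin dI) (j : Fin dI ⊕ Fin dN),
      (M.dstate θ j * X i).trace = if Sum.inl i = j then 1 else 0

/-- The matrix `Z_θ(X)` with entries `tr (X_i ρ_θ X_j)`. -/
noncomputable def zMatrix (X : Fin dI → Matrix (Fin n) (Fin n) ℂ) :
    Matrix (Fin dI) (Fin dI) ℂ :=
  Matrix.of fun i j => (X i * M.state θ * X j).trace

/-- The values of the Holevo objective at the feasible vectors. -/
def holevoValues (W : Matrix (Fin dI) (Fin dI) ℝ) : Set ℝ :=
  {c | ∃ X, M.Feasible θ X ∧ c = weightedBound W (M.zMatrix θ X)}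

/-- The Holevo bound for the parameters of interest in the presence of nuisance parameters. -/
noncomputable def holevoBound (W : Matrix (Fin dI) (Fin dI) ℝ) : ℝ :=
  sInf (M.holevoValues θ W)

/-- D-invariance for the parameters of interest at `θ`. -/
def DInvariantAt : Prop :=
  ∀ i : Fin dI, commOp (M.state θ) (M.effSLD θ i) ∈
    Submodule.span ℝ (Set.range (M.effSLD θ))

/-- D-invariance for the parameters of interest at all points of the model. -/
def DInvariant : Prop :=
  ∀ θ ∈ M.Θ, M.DInvariantAt θ

end Model

end QNuisance

/-!
Fix a parameter, and let `ρ > 0` be the state there. On Hermitian matrices `Z(X)` is the Gram matrix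
of `X` in the right inner product, and the unbiasedness condition says that `X` is dual to the
logarithmic derivatives of interest and orthogonal to the nuisance ones. The proof compares two
Gram matrices: `Z₀ = Z(X₀)`, where `X₀` is the basis of the span of the effective SLDs dual to them
(`Model.dualSLD`), and the inverse `G⁻¹` of the partial RLD Fisher information `G`.

*The RLD inequality.* Every feasible `X` satisfies `⟨X_i, L̃^R_j⟩ = δ_ij`, whatever the coefficients
of the nuisance RLDs in `L̃^R` are, so `Z(X) - G⁻¹` is the Gram matrix of a residual and hence
positive semidefinite (`Model.posSemidef_zMatrix_sub`). The coefficients in the effective RLDs are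
the complex conjugates of those of the orthogonal projection, since the right inner product is
conjugate linear in its first argument. The two agree exactly when the coefficients are real, and
both directions below establish this along the way.

*The weighted bound.* Regularized polar parts of a real antisymmetric matrix show that
`weightedBound W` is, on Hermitian matrices, a supremum of linear functionals that are nonnegative
on positive semidefinite matrices (`testValue`). It is therefore monotone and lower semicontinuous;
with coercivity, the latter gives attainment (`Model.isLeast_holevoBound`).

*Equality of the bounds is equivalent to `Z₀ = G⁻¹`.* If `Z₀ = G⁻¹`, then monotonicity makes `X₀`
a minimizer. Conversely, `X₀` minimizes `Tr (W Re Z(X))`, so equality of the bounds gives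
`Tr (W Re (Z₀ - G⁻¹)) ≤ Tr |W^{1/2} (Im G⁻¹) W^{1/2}|` for all `W > 0`. With `W = E_ii + ε` the
right side tends to `0` because `Im G⁻¹` is antisymmetric, so `Z₀ - G⁻¹ ≥ 0` has zero diagonal and
vanishes (`eq_zero_of_forall_trace_mul_re_le`).

*D-invariance is equivalent to `Z₀ = G⁻¹`.* The identity `ρ X = {ρ, X + i 𝒟 X}`, with `{·, ·}` the
Jordan product, translates between SLDs and RLDs (`mul_eq_jordan`). Equality in the RLD inequality
means that `X₀` is a combination of the effective RLDs. Taking Hermitian parts in the translation of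
this relation shows that it is the same as D-invariance
(`Model.zMatrix_dualSLD_eq_of_dInvariantAt`, `Model.dInvariantAt_of_zMatrix_dualSLD_eq`).
-/

namespace QNuisance

/-! ### Trace pairings of semidefinite matrices -/

section Trace

variable {m : Type*}

/-- The complexification of a real matrix. -/
def complexify (A : Matrix m m ℝ) : Matrix m m ℂ := A.map Complex.ofReal

theorem complexify_transpose (A : Matrix m m ℝ) :
    complexify A.transpose = (complexify A).conjTranspose := by
  ext i j
  simp [complexify]

theorem complexify_re_add_im (Z : Matrix m m ℂ) :
    Z = complexify (Z.map Complex.re) + Complex.I • complexify (Z.map Complex.im) := by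
  ext i j
  simp [complexify, mul_comm Complex.I, Complex.re_add_im]

theorem im_transpose_of_isHermitian {Z : Matrix m m ℂ} (hZ : Z.IsHermitian) :
    (Z.map Complex.im).transpose = -Z.map Complex.im := by
  ext i j
  have := congrArg Complex.im (hZ.apply i j)
  simp at this ⊢
  linarith

variable [Fintype m]

open Classical in
theorem exists_eq_conjTranspose_mul_self {𝕜 : Type*} [RCLike 𝕜] {A : Matrix m m 𝕜}
    (hA : A.PosSemidef) : ∃ C : Matrix m m 𝕜, A = C.conjTranspose * C := by
  refine ⟨CFC.sqrt A, ?_⟩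
  have h0 : 0 ≤ A := Matrix.nonneg_iff_posSemidef.2 hA
  have h := Matrix.nonneg_iff_posSemidef.1 (CFC.sqrt_nonneg A)
  rw [h.isHermitian.eq, CFC.sqrt_mul_sqrt_self A]

theorem trace_mul_nonneg_of_posSemidef {𝕜 : Type*} [RCLike 𝕜] {A B : Matrix m m 𝕜}
    (hA : A.PosSemidef) (hB : B.PosSemidef) : 0 ≤ (A * B).trace := by
  obtain ⟨C, rfl⟩ := exists_eq_conjTranspose_mul_self hA
  rw [Matrix.mul_assoc, Matrix.trace_mul_comm]
  exact (hB.mul_mul_conjTranspose_same C).trace_nonneg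

open Classical in
theorem eq_zero_of_trace_mul_eq_zero {𝕜 : Type*} [RCLike 𝕜] {A B : Matrix m m 𝕜}
    (hA : A.PosDef) (hB : B.PosSemidef) (h : (A * B).trace = 0) : B = 0 := by
  obtain ⟨C, rfl⟩ := exists_eq_conjTranspose_mul_self hA.posSemidef
  rw [Matrix.mul_assoc, Matrix.trace_mul_comm,
    (hB.mul_mul_conjTranspose_same C).trace_eq_zero_iff] at h
  have hu : IsUnit C := by
    have := hA.isUnit
    rw [Matrix.isUnit_iff_isUnit_det, Matrix.det_mul] at this
    exact (Matrix.isUnit_iff_isUnit_det C).2 (isUnit_of_mul_isUnit_right this)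
  exact (hu.star.mul_left_eq_zero.1 ((hu.mul_right_eq_zero).1 (by rwa [← Matrix.mul_assoc])))

theorem complexify_mul (A B : Matrix m m ℝ) :
    complexify (A * B) = complexify A * complexify B := by
  simp only [complexify]
  exact Matrix.map_mul (f := Complex.ofRealHom)

theorem posSemidef_complexify {A : Matrix m m ℝ} (hA : A.PosSemidef) :
    (complexify A).PosSemidef := by
  obtain ⟨C, rfl⟩ := exists_eq_conjTranspose_mul_self hA
  rw [Matrix.conjTranspose_eq_transpose_of_trivial, complexify_mul, complexify_transpose]
  exact Matrix.posSemidef_conjTranspose_mul_self _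

theorem re_trace_complexify_mul (A : Matrix m m ℝ) (Z : Matrix m m ℂ) :
    ((complexify A * Z).trace).re = (A * Z.map Complex.re).trace := by
  simp [Matrix.trace, Matrix.mul_apply, complexify]

theorem trace_mul_re_nonneg {W : Matrix m m ℝ} (hW : W.PosSemidef) {Z : Matrix m m ℂ}
    (hZ : Z.PosSemidef) : 0 ≤ (W * Z.map Complex.re).trace := by
  rw [← re_trace_complexify_mul]
  exact (Complex.nonneg_iff.1
    (trace_mul_nonneg_of_posSemidef (posSemidef_complexify hW) hZ)).1

end Trace

/-! ### The trace norm of a real antisymmetric matrix -/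

section TraceNorm

variable {d : ℕ}

/-- The antisymmetric contractions, the test matrices for the trace norm of a real antisymmetric
matrix. -/
def IsSkewContraction (M : Matrix (Fin d) (Fin d) ℝ) : Prop :=
  M.transpose = -M ∧ (1 - M.transpose * M).PosSemidef

theorem posSemidef_abs (B : Matrix (Fin d) (Fin d) ℝ) : (CFC.abs B).PosSemidef :=
  Matrix.nonneg_iff_posSemidef.1 (CFC.abs_nonneg B)

theorem abs_mul_abs_eq (B : Matrix (Fin d) (Fin d) ℝ) :
    CFC.abs B * CFC.abs B = B.transpose * B := by
  rw [CFC.abs_mul_abs, Matrix.star_eq_conjTranspose, Matrix.conjTranspose_eq_transpose_of_trivial]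

theorem posDef_abs_add (B : Matrix (Fin d) (Fin d) ℝ) {ε : ℝ} (hε : 0 < ε) :
    (CFC.abs B + ε • 1).PosDef :=
  Matrix.PosDef.posSemidef_add (posSemidef_abs B) (Matrix.PosDef.one.smul hε)

theorem trace_mul_inv_mul_transpose (B : Matrix (Fin d) (Fin d) ℝ) {ε : ℝ} (hε : 0 < ε) :
    (B * (CFC.abs B + ε • 1)⁻¹ * B.transpose).trace
      = (CFC.abs B).trace - ε * ((CFC.abs B + ε • 1)⁻¹ * CFC.abs B).trace := by
  have hK := posDef_abs_add B hε
  have hsq := abs_mul_abs_eq B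
  set N := CFC.abs B with hNdef
  set K := N + ε • (1 : Matrix (Fin d) (Fin d) ℝ) with hKdef
  have hdet : IsUnit K.det := (Matrix.isUnit_iff_isUnit_det K).1 hK.isUnit
  have hN : N = K - ε • 1 := by simp [hKdef]
  have h : K⁻¹ * (N * N) = N - ε • (K⁻¹ * N) := by
    conv_lhs => rw [← Matrix.mul_assoc]; enter [1]; rw [hN]
    rw [Matrix.mul_sub, Matrix.nonsing_inv_mul _ hdet, Matrix.sub_mul]
    simp
  rw [Matrix.trace_mul_cycle, ← hsq, Matrix.trace_mul_comm, h, Matrix.trace_sub,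
    Matrix.trace_smul, smul_eq_mul]

/-- The trace norm dominates the pairing with any contraction. With `N = |B|` and
`V = B (N + ε)⁻¹`, expand `0 ≤ Tr (V - M) (N + ε) (V - M)ᵀ` and let `ε → 0`. -/
theorem trace_transpose_mul_le_trace_abs {M : Matrix (Fin d) (Fin d) ℝ}
    (hM : (1 - M.transpose * M).PosSemidef) (B : Matrix (Fin d) (Fin d) ℝ) :
    (M.transpose * B).trace ≤ (CFC.abs B).trace := by
  have key : ∀ ε : ℝ, 0 < ε → 2 * (M.transpose * B).trace ≤ 2 * (CFC.abs B).trace + ε * d := by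
    intro ε hε
    have hK := posDef_abs_add B hε
    have hN := posSemidef_abs B
    have hNN := trace_mul_inv_mul_transpose B hε
    set N := CFC.abs B with hNdef
    set K := N + ε • (1 : Matrix (Fin d) (Fin d) ℝ) with hKdef
    have hdet : IsUnit K.det := (Matrix.isUnit_iff_isUnit_det K).1 hK.isUnit
    have hKt : K.transpose = K := by
      simpa [Matrix.IsSymm] using hK.isHermitian
    have h1 := (hK.posSemidef.mul_mul_conjTranspose_same (M - B * K⁻¹)).trace_nonneg
    have h2 : (M - B * K⁻¹) * K * (M - B * K⁻¹).conjTranspose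
        = M * K * M.transpose - B * M.transpose - M * B.transpose + B * K⁻¹ * B.transpose := by
      have e1 : (B * K⁻¹).transpose = K⁻¹ * B.transpose := by
        rw [Matrix.transpose_mul, Matrix.transpose_nonsing_inv, hKt]
      rw [Matrix.conjTranspose_eq_transpose_of_trivial, Matrix.transpose_sub, e1, Matrix.sub_mul,
        Matrix.nonsing_inv_mul_cancel_right _ _ hdet, Matrix.mul_sub, Matrix.sub_mul,
        Matrix.sub_mul, ← Matrix.mul_assoc (M * K), Matrix.mul_nonsing_inv_cancel_right _ _ hdet,
        ← Matrix.mul_assoc B K⁻¹]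
      abel
    have h3 : (B * M.transpose).trace = (M.transpose * B).trace := Matrix.trace_mul_comm _ _
    have h4 : (M * B.transpose).trace = (M.transpose * B).trace := by
      rw [← Matrix.trace_transpose, Matrix.transpose_mul, Matrix.transpose_transpose, h3]
    have h5 : (M * K * M.transpose).trace ≤ K.trace := by
      have := trace_mul_nonneg_of_posSemidef hK.posSemidef hM
      rw [Matrix.mul_sub, Matrix.mul_one, Matrix.trace_sub, Matrix.trace_mul_comm K,
        Matrix.trace_mul_cycle] at this
      have hc : (M * K * M.transpose).trace = (K * M.transpose * M).trace := by
        rw [Matrix.mul_assoc, Matrix.trace_mul_comm]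
      linarith
    have h6 : K.trace = N.trace + ε * d := by
      simp [hKdef, Matrix.trace_add, Matrix.trace_smul]
    have h7 : 0 ≤ (K⁻¹ * N).trace := trace_mul_nonneg_of_posSemidef hK.inv.posSemidef hN
    rw [h2, Matrix.trace_add, Matrix.trace_sub, Matrix.trace_sub, h3, h4, hNN] at h1
    nlinarith
  refine le_of_forall_pos_le_add fun ε hε => ?_
  have h := key (ε / (d + 1)) (by positivity)
  have h' : ε / (d + 1) * d ≤ ε := by
    rw [div_mul_eq_mul_div, div_le_iff₀ (by positivity)]
    nlinarith
  linarith

/-- Conversely, the trace norm of an antisymmetric `B` is approximated by the pairings with the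
antisymmetric contractions `B (|B| + ε)⁻¹`. -/
theorem exists_isSkewContraction_lt {B : Matrix (Fin d) (Fin d) ℝ} (hB : B.transpose = -B)
    {y : ℝ} (hy : y < (CFC.abs B).trace) :
    ∃ M, IsSkewContraction M ∧ y < (M.transpose * B).trace := by
  obtain ⟨ε, hε, hεy⟩ : ∃ ε : ℝ, 0 < ε ∧ ε * d < (CFC.abs B).trace - y := by
    refine ⟨((CFC.abs B).trace - y) / (d + 1), div_pos (by linarith) (by positivity), ?_⟩
    rw [div_mul_eq_mul_div, div_lt_iff₀ (by positivity)]
    nlinarith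
  have hK := posDef_abs_add B hε
  have hN := posSemidef_abs B
  have hNN := trace_mul_inv_mul_transpose B hε
  have hsq := abs_mul_abs_eq B
  have hcomm : Commute (CFC.abs B) B :=
    CFC.commute_abs_self B ⟨by
      rw [Matrix.star_eq_conjTranspose, Matrix.conjTranspose_eq_transpose_of_trivial, hB]
      exact (Commute.refl B).neg_left⟩
  set N := CFC.abs B with hNdef
  set K := N + ε • (1 : Matrix (Fin d) (Fin d) ℝ) with hKdef
  have hdet : IsUnit K.det := (Matrix.isUnit_iff_isUnit_det K).1 hK.isUnit
  have hKt : K.transpose = K := by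
    simpa [Matrix.IsSymm] using hK.isHermitian
  have hKit : K⁻¹.transpose = K⁻¹ := by rw [Matrix.transpose_nonsing_inv, hKt]
  have hKB : K⁻¹ * B = B * K⁻¹ := by
    have h1 : K * B = B * K := by
      rw [hKdef, Matrix.add_mul, Matrix.mul_add, hcomm.eq]; simp
    calc K⁻¹ * B = K⁻¹ * (B * K) * K⁻¹ := by
          rw [Matrix.mul_assoc, Matrix.mul_nonsing_inv_cancel_right _ _ hdet]
      _ = B * K⁻¹ := by rw [← h1, Matrix.nonsing_inv_mul_cancel_left _ _ hdet]
  refine ⟨B * K⁻¹, ⟨?_, ?_⟩, ?_⟩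
  · rw [Matrix.transpose_mul, hKit, hB, Matrix.mul_neg, hKB]
  · have h1 : 1 - (B * K⁻¹).transpose * (B * K⁻¹)
        = K⁻¹ * ((2 * ε) • N + ε ^ 2 • (1 : Matrix (Fin d) (Fin d) ℝ)) * K⁻¹.conjTranspose := by
      have h2 : (2 * ε) • N + ε ^ 2 • (1 : Matrix (Fin d) (Fin d) ℝ) = K * K - N * N := by
        simp only [hKdef, Matrix.add_mul, Matrix.mul_add, smul_mul_assoc, mul_smul_comm, one_mul,
          mul_one]
        module
      rw [h2, Matrix.conjTranspose_eq_transpose_of_trivial, hKit, Matrix.transpose_mul, hKit,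
        Matrix.mul_sub, Matrix.sub_mul, Matrix.nonsing_inv_mul_cancel_left _ _ hdet,
        Matrix.mul_nonsing_inv _ hdet, hsq]
      simp only [Matrix.mul_assoc]
    rw [h1]
    exact ((hN.smul (by positivity)).add
      (Matrix.PosSemidef.one.smul (by positivity))).mul_mul_conjTranspose_same _
  · have h1 : (K⁻¹ * N).trace ≤ d := by
      have h2 : (K⁻¹ * N) = 1 - ε • K⁻¹ := by
        have : N = K - ε • 1 := by simp [hKdef]
        rw [this, Matrix.mul_sub, Matrix.nonsing_inv_mul _ hdet]
        simp
      have h3 := hK.inv.posSemidef.trace_nonneg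
      rw [h2, Matrix.trace_sub, Matrix.trace_smul, Matrix.trace_one, Fintype.card_fin, smul_eq_mul]
      nlinarith
    rw [Matrix.transpose_mul, hKit, Matrix.mul_assoc, Matrix.trace_mul_comm,
      ← Matrix.trace_mul_cycle, hNN]
    nlinarith

/-- The trace norm is at most `√d` times the Frobenius norm. -/
theorem sq_trace_abs_le (B : Matrix (Fin d) (Fin d) ℝ) :
    (CFC.abs B).trace ^ 2 ≤ d * (B.transpose * B).trace := by
  rw [← abs_mul_abs_eq]
  have hN := (posSemidef_abs B).isHermitian
  set N := CFC.abs B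
  have h1 := sq_sum_le_card_mul_sum_sq (s := Finset.univ) (f := fun i => N i i)
  simp only [Finset.card_univ, Fintype.card_fin] at h1
  refine h1.trans (mul_le_mul_of_nonneg_left (Finset.sum_le_sum fun i _ => ?_) (by positivity))
  have h2 : (N * N).diag i = ∑ j, N i j ^ 2 := by
    simp only [Matrix.diag_apply, Matrix.mul_apply]
    exact Finset.sum_congr rfl fun j _ => by
      rw [sq]; congr 1; simpa using hN.apply i j
  rw [h2]
  exact Finset.single_le_sum (f := fun j => N i j ^ 2) (fun j _ => sq_nonneg _) (Finset.mem_univ i)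

end TraceNorm

/-! ### The weighted bound as a supremum of monotone linear functionals -/

section WeightedBound

variable {d : ℕ} {W : Matrix (Fin d) (Fin d) ℝ}

theorem posSemidef_one_add_I_smul {M : Matrix (Fin d) (Fin d) ℝ} (hM : IsSkewContraction M) :
    (1 + Complex.I • complexify M).PosSemidef := by
  set H := Complex.I • complexify M with hH
  have hHh : H.conjTranspose = H := by
    rw [hH, Matrix.conjTranspose_smul, ← complexify_transpose, hM.1]
    ext i j
    simp [complexify]
  have hHH : complexify (1 - M.transpose * M) = 1 - H * H := by
    have : complexify (1 - M.transpose * M) = 1 - complexify (M.transpose * M) := by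
      ext i j
      simp [complexify, Matrix.one_apply, apply_ite]
    rw [this, complexify_mul, complexify_transpose, hH]
    rw [← complexify_transpose, hM.1]
    have h2 : complexify (-M) = -complexify M := by ext i j; simp [complexify]
    rw [h2, smul_mul_smul_comm, Complex.I_mul_I]
    simp
  have h := ((Matrix.posSemidef_conjTranspose_mul_self (1 + H)).add
    (posSemidef_complexify hM.2)).smul (show (0 : ℝ) ≤ 1 / 2 by norm_num)
  convert h using 1
  rw [hHH, Matrix.conjTranspose_add, hHh, Matrix.conjTranspose_one]
  simp only [Matrix.add_mul, Matrix.mul_add, one_mul, mul_one]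
  module

/-- The linear functional of `Z` that an antisymmetric contraction `M` contributes to
`weightedBound W Z`. -/
noncomputable def testValue (W M : Matrix (Fin d) (Fin d) ℝ) (Z : Matrix (Fin d) (Fin d) ℂ) : ℝ :=
  (W * Z.map Complex.re).trace +
    (M.transpose * (CFC.sqrt W * Z.map Complex.im * CFC.sqrt W)).trace

theorem sqrt_mul_sqrt (hW : W.PosSemidef) : CFC.sqrt W * CFC.sqrt W = W := by
  have h0 : 0 ≤ W := Matrix.nonneg_iff_posSemidef.2 hW
  exact CFC.sqrt_mul_sqrt_self W

theorem posSemidef_sqrt (W : Matrix (Fin d) (Fin d) ℝ) : (CFC.sqrt W).PosSemidef :=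
  Matrix.nonneg_iff_posSemidef.1 (CFC.sqrt_nonneg W)

theorem transpose_sqrt (W : Matrix (Fin d) (Fin d) ℝ) : (CFC.sqrt W).transpose = CFC.sqrt W := by
  simpa [Matrix.IsSymm] using (posSemidef_sqrt W).isHermitian

theorem testValue_sub (W M : Matrix (Fin d) (Fin d) ℝ) (Z Z' : Matrix (Fin d) (Fin d) ℂ) :
    testValue W M (Z - Z') = testValue W M Z - testValue W M Z' := by
  have h1 : (Z - Z').map Complex.re = Z.map Complex.re - Z'.map Complex.re := by ext; simp
  have h2 : (Z - Z').map Complex.im = Z.map Complex.im - Z'.map Complex.im := by ext; simp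
  simp only [testValue, h1, h2, Matrix.mul_sub, Matrix.sub_mul, Matrix.trace_sub]
  ring

theorem continuous_testValue (W M : Matrix (Fin d) (Fin d) ℝ) : Continuous (testValue W M) := by
  unfold testValue
  refine Continuous.add ?_ ?_
  · exact (continuous_const.matrix_mul
      (continuous_id.matrix_map Complex.continuous_re)).matrix_trace
  · exact (continuous_const.matrix_mul ((continuous_const.matrix_mul
      (continuous_id.matrix_map Complex.continuous_im)).matrix_mul continuous_const)).matrix_trace

/-- The functional is the pairing of the positive semidefinite matrices `1 + iM` and
`W^{1/2} Z W^{1/2}`. -/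
theorem testValue_nonneg (hW : W.PosSemidef) {M : Matrix (Fin d) (Fin d) ℝ}
    (hM : IsSkewContraction M) {Z : Matrix (Fin d) (Fin d) ℂ} (hZ : Z.PosSemidef) :
    0 ≤ testValue W M Z := by
  set S := CFC.sqrt W with hS
  have hSc : (complexify S).conjTranspose = complexify S := by
    rw [← complexify_transpose, transpose_sqrt]
  have hQ : (complexify S * Z * complexify S).PosSemidef := by
    have := hZ.mul_mul_conjTranspose_same (complexify S)
    rwa [hSc] at this
  have h := (Complex.nonneg_iff.1
    (trace_mul_nonneg_of_posSemidef (posSemidef_one_add_I_smul hM) hQ)).1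
  have hZ' : complexify S * Z * complexify S = complexify (S * Z.map Complex.re * S)
      + Complex.I • complexify (S * Z.map Complex.im * S) := by
    conv_lhs => rw [complexify_re_add_im Z]
    simp only [complexify_mul, Matrix.mul_add, Matrix.add_mul, mul_smul_comm, smul_mul_assoc]
  have htr : ∀ A : Matrix (Fin d) (Fin d) ℝ, (complexify A).trace = (A.trace : ℂ) := by
    intro A; simp [Matrix.trace, complexify]
  rw [hZ', Matrix.add_mul, one_mul, Matrix.mul_add, smul_mul_smul_comm, smul_mul_assoc,
    Complex.I_mul_I, ← complexify_mul, ← complexify_mul] at h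
  simp only [Matrix.trace_add, Matrix.trace_smul, htr] at h
  have hre : (W * Z.map Complex.re).trace = (S * Z.map Complex.re * S).trace := by
    rw [Matrix.trace_mul_cycle S, hS, sqrt_mul_sqrt hW]
  rw [testValue, hM.1, ← hS, hre, Matrix.neg_mul, Matrix.trace_neg]
  simpa using h

theorem testValue_le_weightedBound {M : Matrix (Fin d) (Fin d) ℝ} (hM : IsSkewContraction M)
    (Z : Matrix (Fin d) (Fin d) ℂ) : testValue W M Z ≤ weightedBound W Z :=
  add_le_add le_rfl (trace_transpose_mul_le_trace_abs hM.2 _)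

/-- The weighted bound of a Hermitian matrix is the supremum of the test values. -/
theorem exists_lt_testValue {Z : Matrix (Fin d) (Fin d) ℂ} (hZ : Z.IsHermitian) {y : ℝ}
    (hy : y < weightedBound W Z) : ∃ M, IsSkewContraction M ∧ y < testValue W M Z := by
  have hB : (CFC.sqrt W * Z.map Complex.im * CFC.sqrt W).transpose
      = -(CFC.sqrt W * Z.map Complex.im * CFC.sqrt W) := by
    rw [Matrix.transpose_mul, Matrix.transpose_mul, transpose_sqrt,
      im_transpose_of_isHermitian hZ, Matrix.neg_mul, Matrix.mul_neg, Matrix.mul_assoc]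
  obtain ⟨M, hM, h⟩ := exists_isSkewContraction_lt hB
    (y := y - (W * Z.map Complex.re).trace) (by rw [weightedBound] at hy; linarith)
  exact ⟨M, hM, by rw [testValue]; linarith⟩

/-- The weighted bound is monotone in the Loewner order, being a supremum of functionals that are
nonnegative on positive semidefinite matrices. -/
theorem weightedBound_mono (hW : W.PosSemidef) {Z Z' : Matrix (Fin d) (Fin d) ℂ}
    (hZ : Z.IsHermitian) (h : (Z' - Z).PosSemidef) : weightedBound W Z ≤ weightedBound W Z' := by
  refine le_of_forall_lt fun y hy => ?_
  obtain ⟨M, hM, hyM⟩ := exists_lt_testValue hZ hy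
  have h1 := testValue_nonneg hW hM h
  rw [testValue_sub] at h1
  linarith [testValue_le_weightedBound (W := W) hM Z']

theorem trace_mul_re_le_weightedBound (W : Matrix (Fin d) (Fin d) ℝ)
    (Z : Matrix (Fin d) (Fin d) ℂ) : (W * Z.map Complex.re).trace ≤ weightedBound W Z :=
  le_add_of_nonneg_right (posSemidef_abs _).trace_nonneg

theorem sq_weightedBound_sub_le (hW : W.PosSemidef) (Z : Matrix (Fin d) (Fin d) ℂ) :
    (weightedBound W Z - (W * Z.map Complex.re).trace) ^ 2 ≤
      d * (W * (Z.map Complex.im).transpose * W * Z.map Complex.im).trace := by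
  rw [weightedBound, add_sub_cancel_left]
  refine (sq_trace_abs_le _).trans (le_of_eq ?_)
  congr 1
  rw [Matrix.transpose_mul, Matrix.transpose_mul, transpose_sqrt]
  conv_rhs => rw [← sqrt_mul_sqrt hW]
  simp only [Matrix.mul_assoc]
  rw [Matrix.trace_mul_comm]
  conv_rhs => rw [Matrix.trace_mul_comm]
  simp only [Matrix.mul_assoc]
  conv_rhs => rw [Matrix.trace_mul_comm]
  simp only [Matrix.mul_assoc]

/-- Probing with the weights `E_ii + ε` as `ε → 0`: if `P` is positive semidefinite and
`Tr (W Re P)` never exceeds the trace-norm term of `weightedBound W Z`, then `P = 0`, because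
that term vanishes in the limit. -/
theorem eq_zero_of_forall_trace_mul_re_le {P Z : Matrix (Fin d) (Fin d) ℂ} (hP : P.PosSemidef)
    (hZ : Z.IsHermitian)
    (h : ∀ W : Matrix (Fin d) (Fin d) ℝ, W.PosDef →
      (W * P.map Complex.re).trace ≤ weightedBound W Z - (W * Z.map Complex.re).trace) :
    P = 0 := by
  have hdiag : ∀ i, (P i i).re = 0 := by
    intro i
    set E : Matrix (Fin d) (Fin d) ℝ := Matrix.single i i 1 with hE
    have hEp : E.PosSemidef := by
      rw [hE, ← Matrix.diagonal_single]
      exact Matrix.PosSemidef.diagonal (Pi.single_nonneg.2 zero_le_one)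
    set K := Z.map Complex.im with hK
    let V : ℝ → Matrix (Fin d) (Fin d) ℝ := fun ε => E + ε • 1
    have hV : Continuous V := by fun_prop
    have hle : ∀ ε : ℝ, 0 < ε → (V ε * P.map Complex.re).trace ^ 2
        ≤ d * (V ε * K.transpose * V ε * K).trace := by
      intro ε hε
      have hW : (V ε).PosDef :=
        Matrix.PosDef.posSemidef_add hEp (Matrix.PosDef.one.smul hε)
      refine (pow_le_pow_left₀ (trace_mul_re_nonneg hW.posSemidef hP) (h _ hW) 2).trans ?_
      exact sq_weightedBound_sub_le hW.posSemidef Z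
    have hlim : (V 0 * P.map Complex.re).trace ^ 2 ≤ d * (V 0 * K.transpose * V 0 * K).trace := by
      have c1 : Continuous fun ε => (V ε * P.map Complex.re).trace ^ 2 :=
        ((hV.matrix_mul continuous_const).matrix_trace).pow 2
      have c2 : Continuous fun ε => d * (V ε * K.transpose * V ε * K).trace :=
        continuous_const.mul ((((hV.matrix_mul continuous_const).matrix_mul hV).matrix_mul
          continuous_const).matrix_trace)
      exact le_of_tendsto_of_tendsto
        ((c1.tendsto 0).mono_left nhdsWithin_le_nhds) ((c2.tendsto 0).mono_left nhdsWithin_le_nhds)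
        (Filter.eventually_of_mem (self_mem_nhdsWithin (s := Set.Ioi 0)) hle)
    have hKii : K i i = 0 := by
      have := congrFun (congrFun (im_transpose_of_isHermitian hZ) i) i
      simp at this
      simp only [hK, Matrix.map_apply]
      linarith
    have e1 : (V 0 * P.map Complex.re).trace = (P i i).re := by
      simp [V, hE, Matrix.trace_single_mul]
    have e2 : (V 0 * K.transpose * V 0 * K).trace = 0 := by
      simp only [V, zero_smul, add_zero, hE, Matrix.single_mul_mul_single, Matrix.transpose_apply,
        hKii]
      simp
    rw [e1, e2, mul_zero] at hlim
    exact pow_eq_zero_iff (two_ne_zero) |>.1 (le_antisymm hlim (sq_nonneg _))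
  refine hP.trace_eq_zero_iff.1 (Finset.sum_eq_zero fun i _ => Complex.ext (hdiag i) ?_)
  exact (Complex.nonneg_iff.1 hP.diag_nonneg).2.symm

end WeightedBound

/-! ### Gram matrices of the right inner product -/

section Gram

variable {n : ℕ} {ι κ ι' κ' : Type*} {ρ : Matrix (Fin n) (Fin n) ℂ}

/-- The family `i ↦ ∑ j, F i j • Y j` of combinations of `Y` with coefficient matrix `F`. -/
def combine {R V : Type*} [Fintype κ] [AddCommMonoid V] [SMul R V] (F : Matrix ι κ R)
    (Y : κ → V) : ι → V :=
  fun i => ∑ j, F i j • Y j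

theorem combine_mul {R V : Type*} [Semiring R] [AddCommMonoid V] [Module R V] [Fintype κ]
    [Fintype κ'] (F : Matrix ι κ R) (H : Matrix κ κ' R) (Y : κ' → V) :
    combine (F * H) Y = combine F (combine H Y) := by
  ext1 i
  simp only [combine, Matrix.mul_apply, Finset.sum_smul, Finset.smul_sum, mul_smul]
  exact Finset.sum_comm

theorem combine_one {R V : Type*} [Semiring R] [AddCommMonoid V] [Module R V] [Fintype κ]
    [DecidableEq κ] (Y : κ → V) : combine (1 : Matrix κ κ R) Y = Y := by
  ext1 i
  simp [combine, Matrix.one_apply]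

theorem map_combine {R V V' : Type*} [Semiring R] [AddCommMonoid V] [Module R V]
    [AddCommMonoid V'] [Module R V'] [Fintype κ] (f : V →ₗ[R] V') (F : Matrix ι κ R) (Y : κ → V)
    (i : ι) : f (combine F Y i) = combine F (fun k => f (Y k)) i := by
  simp [combine]

theorem combine_ofReal [Fintype κ] (F : Matrix ι κ ℝ) (Y : κ → Matrix (Fin n) (Fin n) ℂ) :
    combine (F.map Complex.ofReal) Y = combine F Y := by
  ext1 i
  simp [combine, Complex.coe_smul]

theorem isHermitian_combine [Fintype κ] (F : Matrix ι κ ℝ) {Y : κ → Matrix (Fin n) (Fin n) ℂ}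
    (hY : ∀ k, (Y k).IsHermitian) (i : ι) : (combine F Y i).IsHermitian := by
  rw [Matrix.IsHermitian, combine, Matrix.conjTranspose_sum]
  refine Finset.sum_congr rfl fun k _ => ?_
  rw [Matrix.conjTranspose_smul, (hY k).eq, star_trivial]

theorem star_rldInner (hρ : ρ.IsHermitian) (X Y : Matrix (Fin n) (Fin n) ℂ) :
    star (rldInner ρ X Y) = rldInner ρ Y X := by
  rw [rldInner, rldInner, ← Matrix.trace_conjTranspose, Matrix.conjTranspose_mul,
    Matrix.conjTranspose_mul, Matrix.conjTranspose_conjTranspose, hρ.eq, ← Matrix.mul_assoc,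
    Matrix.trace_mul_cycle]

theorem rldInner_combine_right [Fintype κ] (X : Matrix (Fin n) (Fin n) ℂ) (F : Matrix ι κ ℂ)
    (Y : κ → Matrix (Fin n) (Fin n) ℂ) (i : ι) :
    rldInner ρ X (combine F Y i) = ∑ k, F i k * rldInner ρ X (Y k) := by
  simp [rldInner, combine, Matrix.mul_sum, Matrix.sum_mul, Matrix.trace_sum]

theorem rldInner_combine_left [Fintype κ] (X : Matrix (Fin n) (Fin n) ℂ) (F : Matrix ι κ ℂ)
    (Y : κ → Matrix (Fin n) (Fin n) ℂ) (i : ι) :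
    rldInner ρ (combine F Y i) X = ∑ k, star (F i k) * rldInner ρ (Y k) X := by
  simp [rldInner, combine, Matrix.mul_sum, Matrix.conjTranspose_sum, Matrix.trace_sum]

theorem rldInner_sub_left (X X' Y : Matrix (Fin n) (Fin n) ℂ) :
    rldInner ρ (X - X') Y = rldInner ρ X Y - rldInner ρ X' Y := by
  simp [rldInner, Matrix.mul_sub, Matrix.trace_sub]

theorem rldInner_sub_right (X Y Y' : Matrix (Fin n) (Fin n) ℂ) :
    rldInner ρ X (Y - Y') = rldInner ρ X Y - rldInner ρ X Y' := by
  simp [rldInner, Matrix.mul_sub, Matrix.sub_mul, Matrix.trace_sub]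

theorem rldInner_self (X : Matrix (Fin n) (Fin n) ℂ) :
    rldInner ρ X X = (ρ * (X * X.conjTranspose)).trace := by
  rw [rldInner, Matrix.mul_assoc]

theorem rldInner_self_nonneg (hρ : ρ.PosSemidef) (X : Matrix (Fin n) (Fin n) ℂ) :
    0 ≤ rldInner ρ X X := by
  rw [rldInner_self]
  exact trace_mul_nonneg_of_posSemidef hρ (Matrix.posSemidef_self_mul_conjTranspose X)

theorem eq_zero_of_rldInner_self (hρ : ρ.PosDef) {X : Matrix (Fin n) (Fin n) ℂ}
    (h : rldInner ρ X X = 0) : X = 0 := by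
  rw [rldInner_self] at h
  exact Matrix.self_mul_conjTranspose_eq_zero.1
    (eq_zero_of_trace_mul_eq_zero hρ (Matrix.posSemidef_self_mul_conjTranspose X) h)

/-- The matrix of right inner products between two families. -/
noncomputable def crossGram (ρ : Matrix (Fin n) (Fin n) ℂ) (X : ι → Matrix (Fin n) (Fin n) ℂ)
    (Y : κ → Matrix (Fin n) (Fin n) ℂ) : Matrix ι κ ℂ :=
  Matrix.of fun i j => rldInner ρ (X i) (Y j)

theorem conjTranspose_crossGram (hρ : ρ.IsHermitian) (X : ι → Matrix (Fin n) (Fin n) ℂ)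
    (Y : κ → Matrix (Fin n) (Fin n) ℂ) :
    (crossGram ρ X Y).conjTranspose = crossGram ρ Y X := by
  ext i j
  exact star_rldInner hρ _ _

theorem crossGram_combine_right [Fintype κ] (X : ι → Matrix (Fin n) (Fin n) ℂ)
    (F : Matrix ι' κ ℂ) (Y : κ → Matrix (Fin n) (Fin n) ℂ) :
    crossGram ρ X (combine F Y) = crossGram ρ X Y * F.transpose := by
  ext i j
  simp [crossGram, rldInner_combine_right, Matrix.mul_apply, mul_comm]

theorem crossGram_combine_left [Fintype κ] (X : ι → Matrix (Fin n) (Fin n) ℂ)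
    (F : Matrix ι' κ ℂ) (Y : κ → Matrix (Fin n) (Fin n) ℂ) :
    crossGram ρ (combine F Y) X = F.map star * crossGram ρ Y X := by
  ext i j
  simp [crossGram, rldInner_combine_left, Matrix.mul_apply]

theorem crossGram_sub_right (X : ι → Matrix (Fin n) (Fin n) ℂ)
    (Y Y' : κ → Matrix (Fin n) (Fin n) ℂ) :
    crossGram ρ X (Y - Y') = crossGram ρ X Y - crossGram ρ X Y' := by
  ext i j
  simp [crossGram, rldInner_sub_right]

theorem crossGram_sub_left (X X' : ι → Matrix (Fin n) (Fin n) ℂ)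
    (Y : κ → Matrix (Fin n) (Fin n) ℂ) :
    crossGram ρ (X - X') Y = crossGram ρ X Y - crossGram ρ X' Y := by
  ext i j
  simp [crossGram, rldInner_sub_left]

/-- The quadratic form of a Gram matrix is the square norm of a combination of the family. -/
theorem dotProduct_crossGram [Fintype ι] (Y : ι → Matrix (Fin n) (Fin n) ℂ) (x : ι → ℂ) :
    star x ⬝ᵥ (crossGram ρ Y Y).mulVec x = rldInner ρ (∑ i, x i • Y i) (∑ i, x i • Y i) := by
  have h := rldInner_combine_left (ρ := ρ) (∑ i, x i • Y i) (Matrix.of fun _ : Unit => x) Y ()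
  have h' : ∀ X, _ = _ :=
    fun X => rldInner_combine_right (ρ := ρ) X (Matrix.of fun _ : Unit => x) Y ()
  simp only [combine, Matrix.of_apply] at h h'
  rw [h]
  simp only [h', dotProduct, Matrix.mulVec, crossGram, Matrix.of_apply, Pi.star_apply, mul_comm]

theorem posSemidef_crossGram [Fintype ι] (hρ : ρ.PosSemidef)
    (Y : ι → Matrix (Fin n) (Fin n) ℂ) : (crossGram ρ Y Y).PosSemidef := by
  refine Matrix.PosSemidef.of_dotProduct_mulVec_nonneg
    (conjTranspose_crossGram hρ.isHermitian Y Y) fun x => ?_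
  rw [dotProduct_crossGram]
  exact rldInner_self_nonneg hρ _

theorem posDef_crossGram [Fintype ι] (hρ : ρ.PosDef) {Y : ι → Matrix (Fin n) (Fin n) ℂ}
    (hY : LinearIndependent ℂ Y) : (crossGram ρ Y Y).PosDef := by
  refine Matrix.PosDef.of_dotProduct_mulVec_pos
    (conjTranspose_crossGram hρ.isHermitian Y Y) fun x hx => ?_
  rw [dotProduct_crossGram]
  refine lt_of_le_of_ne (rldInner_self_nonneg hρ.posSemidef _) fun h => hx ?_
  exact funext (Fintype.linearIndependent_iff.1 hY x (eq_zero_of_rldInner_self hρ h.symm))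

theorem dotProduct_crossGram_re [Fintype ι] (Y : ι → Matrix (Fin n) (Fin n) ℂ) (x : ι → ℝ) :
    star x ⬝ᵥ ((crossGram ρ Y Y).map Complex.re).mulVec x
      = (rldInner ρ (∑ i, x i • Y i) (∑ i, x i • Y i)).re := by
  have h := congrArg Complex.re (dotProduct_crossGram (ρ := ρ) Y fun i => (x i : ℂ))
  simp only [Complex.coe_smul] at h
  rw [← h]
  simp [dotProduct, Matrix.mulVec, Finset.mul_sum]

theorem isHermitian_map_re {Z : Matrix ι ι ℂ} (hZ : Z.IsHermitian) :
    (Z.map Complex.re).IsHermitian := by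
  ext i j
  have := congrArg Complex.re (hZ.apply i j)
  simpa using this

theorem posSemidef_crossGram_re [Fintype ι] (hρ : ρ.PosSemidef)
    (Y : ι → Matrix (Fin n) (Fin n) ℂ) : ((crossGram ρ Y Y).map Complex.re).PosSemidef := by
  refine Matrix.PosSemidef.of_dotProduct_mulVec_nonneg
    (isHermitian_map_re (conjTranspose_crossGram hρ.isHermitian Y Y)) fun x => ?_
  rw [dotProduct_crossGram_re]
  exact (Complex.nonneg_iff.1 (rldInner_self_nonneg hρ _)).1

theorem posDef_crossGram_re [Fintype ι] (hρ : ρ.PosDef) {Y : ι → Matrix (Fin n) (Fin n) ℂ}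
    (hY : LinearIndependent ℝ Y) : ((crossGram ρ Y Y).map Complex.re).PosDef := by
  refine Matrix.PosDef.of_dotProduct_mulVec_pos
    (isHermitian_map_re (conjTranspose_crossGram hρ.isHermitian Y Y)) fun x hx => ?_
  rw [dotProduct_crossGram_re]
  have h0 := Complex.nonneg_iff.1
    (rldInner_self_nonneg hρ.posSemidef (∑ i, x i • Y i))
  refine lt_of_le_of_ne h0.1 fun h => hx ?_
  exact funext (Fintype.linearIndependent_iff.1 hY x
    (eq_zero_of_rldInner_self hρ (Complex.ext h.symm h0.2.symm)))

theorem crossGram_re_combine_left [Fintype κ] (X : ι → Matrix (Fin n) (Fin n) ℂ)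
    (F : Matrix ι' κ ℝ) (Y : κ → Matrix (Fin n) (Fin n) ℂ) :
    (crossGram ρ (combine F Y) X).map Complex.re = F * (crossGram ρ Y X).map Complex.re := by
  rw [← combine_ofReal, crossGram_combine_left]
  ext i j
  simp [Matrix.mul_apply]

theorem crossGram_sub_left_re (X X' : ι → Matrix (Fin n) (Fin n) ℂ)
    (Y : κ → Matrix (Fin n) (Fin n) ℂ) :
    (crossGram ρ (X - X') Y).map Complex.re
      = (crossGram ρ X Y).map Complex.re - (crossGram ρ X' Y).map Complex.re := by
  rw [crossGram_sub_left]
  ext i j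
  simp

theorem crossGram_sub_right_re (X : ι → Matrix (Fin n) (Fin n) ℂ)
    (Y Y' : κ → Matrix (Fin n) (Fin n) ℂ) :
    (crossGram ρ X (Y - Y')).map Complex.re
      = (crossGram ρ X Y).map Complex.re - (crossGram ρ X Y').map Complex.re := by
  rw [crossGram_sub_right]
  ext i j
  simp

theorem crossGram_re_combine_right [Fintype κ] (X : ι → Matrix (Fin n) (Fin n) ℂ)
    (F : Matrix ι' κ ℝ) (Y : κ → Matrix (Fin n) (Fin n) ℂ) :
    (crossGram ρ X (combine F Y)).map Complex.re
      = (crossGram ρ X Y).map Complex.re * F.transpose := by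
  rw [← combine_ofReal, crossGram_combine_right]
  ext i j
  simp [Matrix.mul_apply]

theorem transpose_crossGram_re (hρ : ρ.IsHermitian) (X : ι → Matrix (Fin n) (Fin n) ℂ)
    (Y : κ → Matrix (Fin n) (Fin n) ℂ) :
    ((crossGram ρ X Y).map Complex.re).transpose = (crossGram ρ Y X).map Complex.re := by
  rw [← conjTranspose_crossGram hρ X Y]
  ext i j
  simp

/-! ### Families dual to each other -/

/-- A family with a dual family is linearly independent. -/
theorem linearIndependent_of_crossGram_eq_one [Fintype ι] [DecidableEq ι]
    {X T : ι → Matrix (Fin n) (Fin n) ℂ} (h : crossGram ρ X T = 1) : LinearIndependent ℂ T := by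
  rw [Fintype.linearIndependent_iff]
  intro v hv i
  have h1 := rldInner_combine_right (ρ := ρ) (X i) (Matrix.of fun _ : Unit => v) T ()
  simp only [combine, Matrix.of_apply, hv] at h1
  have h2 : ∀ j, rldInner ρ (X i) (T j) = (1 : Matrix ι ι ℂ) i j := fun j => by rw [← h]; rfl
  simp only [h2] at h1
  simpa [Matrix.one_apply, rldInner] using h1.symm

/-- The Gram matrix of the residual of `X` after projection to the span of a family `T` to which
`X` is dual. -/
theorem crossGram_residual [Fintype ι] [DecidableEq ι] (hρ : ρ.PosDef)
    {X T : ι → Matrix (Fin n) (Fin n) ℂ} (h : crossGram ρ X T = 1) :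
    crossGram ρ X X - (crossGram ρ T T)⁻¹ =
      crossGram ρ (X - combine (crossGram ρ T T)⁻¹.transpose T)
        (X - combine (crossGram ρ T T)⁻¹.transpose T) := by
  have hG := posDef_crossGram hρ (linearIndependent_of_crossGram_eq_one h)
  have h' : crossGram ρ T X = 1 := by
    rw [← conjTranspose_crossGram hρ.isHermitian, h, Matrix.conjTranspose_one]
  set G := crossGram ρ T T with hGdef
  have hdet : IsUnit G.det := (Matrix.isUnit_iff_isUnit_det G).1 hG.isUnit
  have hs : G⁻¹.transpose.map star = G⁻¹ := hG.inv.isHermitian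
  rw [crossGram_sub_left, crossGram_sub_right, crossGram_sub_right, crossGram_combine_right,
    crossGram_combine_right, crossGram_combine_left, crossGram_combine_left, h, h', hs,
    Matrix.transpose_transpose, ← hGdef, Matrix.nonsing_inv_mul _ hdet]
  simp

theorem posSemidef_crossGram_sub_inv [Fintype ι] [DecidableEq ι] (hρ : ρ.PosDef)
    {X T : ι → Matrix (Fin n) (Fin n) ℂ} (h : crossGram ρ X T = 1) :
    (crossGram ρ X X - (crossGram ρ T T)⁻¹).PosSemidef := by
  rw [crossGram_residual hρ h]
  exact posSemidef_crossGram hρ.posSemidef _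

theorem eq_combine_of_crossGram_eq_inv [Fintype ι] [DecidableEq ι] (hρ : ρ.PosDef)
    {X T : ι → Matrix (Fin n) (Fin n) ℂ} (h : crossGram ρ X T = 1)
    (hX : crossGram ρ X X = (crossGram ρ T T)⁻¹) :
    X = combine (crossGram ρ T T)⁻¹.transpose T := by
  have h1 := crossGram_residual hρ h
  rw [hX, sub_self] at h1
  ext1 i
  refine sub_eq_zero.1 (eq_zero_of_rldInner_self hρ ?_)
  exact (congrFun (congrFun h1 i) i).symm

end Gram

/-! ### Hermitian matrices, the Jordan product and the commutation operator -/

section Jordan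

variable {n : ℕ} {ρ : Matrix (Fin n) (Fin n) ℂ}

/-- A matrix has at most one decomposition into Hermitian real and imaginary parts. -/
theorem add_I_smul_inj {X X' Y Y' : Matrix (Fin n) (Fin n) ℂ} (hX : X.IsHermitian)
    (hX' : X'.IsHermitian) (hY : Y.IsHermitian) (hY' : Y'.IsHermitian)
    (h : X + Complex.I • Y = X' + Complex.I • Y') : X = X' ∧ Y = Y' := by
  have h2 := congrArg Matrix.conjTranspose h
  simp only [Matrix.conjTranspose_add, Matrix.conjTranspose_smul, hX.eq, hX'.eq, hY.eq, hY'.eq,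
    Complex.star_def, Complex.conj_I] at h2
  have hXX : X = X' := by
    have : (2 : ℂ) • X = (2 : ℂ) • X' := by
      calc (2 : ℂ) • X = X + Complex.I • Y + (X + -Complex.I • Y) := by module
        _ = (2 : ℂ) • X' := by rw [h, h2]; module
    exact smul_right_injective _ (two_ne_zero) this
  refine ⟨hXX, ?_⟩
  rw [hXX] at h
  exact smul_right_injective _ Complex.I_ne_zero (add_left_cancel h)

theorem combine_eq_re_add_im {ι κ : Type*} [Fintype κ] (F : Matrix ι κ ℂ)
    (Y : κ → Matrix (Fin n) (Fin n) ℂ) (i : ι) :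
    combine F Y i =
      combine (F.map Complex.re) Y i + Complex.I • combine (F.map Complex.im) Y i := by
  simp only [combine, Finset.smul_sum, ← Finset.sum_add_distrib, Matrix.map_apply]
  refine Finset.sum_congr rfl fun k _ => ?_
  rw [← Complex.coe_smul, ← Complex.coe_smul, smul_smul, ← add_smul, mul_comm Complex.I,
    Complex.re_add_im]

/-- Hermitian matrices that are linearly independent over `ℝ` are so over `ℂ`. -/
theorem linearIndependent_complex {ι : Type*} [Fintype ι] {Y : ι → Matrix (Fin n) (Fin n) ℂ}
    (hY : ∀ i, (Y i).IsHermitian) (h : LinearIndependent ℝ Y) : LinearIndependent ℂ Y := by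
  rw [Fintype.linearIndependent_iff] at h ⊢
  intro g hg i
  have h1 := combine_eq_re_add_im (Matrix.of fun _ : Unit => g) Y ()
  have h0 : combine (Matrix.of fun _ : Unit => g) Y () = 0 := hg
  rw [h0] at h1
  obtain ⟨hr, hi⟩ := add_I_smul_inj (X := 0) (Y := 0) Matrix.isHermitian_zero
    (isHermitian_combine _ hY ()) Matrix.isHermitian_zero (isHermitian_combine _ hY ())
    (by rw [smul_zero, add_zero]; exact h1)
  exact Complex.ext (h _ hr.symm i) (h _ hi.symm i)

/-- The Jordan product `X ↦ (X ρ + ρ X) / 2` with `ρ`. -/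
noncomputable def jordan (ρ : Matrix (Fin n) (Fin n) ℂ) :
    Matrix (Fin n) (Fin n) ℂ →ₗ[ℂ] Matrix (Fin n) (Fin n) ℂ :=
  (1 / 2 : ℂ) • (LinearMap.mulRight ℂ ρ + LinearMap.mulLeft ℂ ρ)

theorem jordan_apply (X : Matrix (Fin n) (Fin n) ℂ) :
    jordan ρ X = (1 / 2 : ℂ) • (X * ρ + ρ * X) := rfl

theorem jordan_injective (hρ : ρ.PosDef) : Function.Injective (jordan ρ) := by
  rw [← LinearMap.ker_eq_bot, LinearMap.ker_eq_bot']
  intro X hX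
  rw [jordan_apply, smul_eq_zero_iff_right (by norm_num), add_comm] at hX
  exact anticomm_eq_zero hρ hX

theorem jordan_sldOf (hρ : ρ.PosDef) (A : Matrix (Fin n) (Fin n) ℂ) :
    jordan ρ (sldOf ρ A) = A :=
  (sldOf_spec hρ A).symm

/-- The commutation operator intertwines left multiplication by `ρ` with the Jordan product. -/
theorem mul_eq_jordan (hρ : ρ.PosDef) (X : Matrix (Fin n) (Fin n) ℂ) :
    ρ * X = jordan ρ (X + Complex.I • commOp ρ X) := by
  have h := commOp_spec hρ X
  rw [map_add, map_smul, jordan_apply, jordan_apply]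
  have h2 : Complex.I • (1 / 2 : ℂ) • (commOp ρ X * ρ + ρ * commOp ρ X)
      = (1 / 2 : ℂ) • (ρ * X - X * ρ) := by
    rw [h, smul_comm, smul_add, add_comm]
  rw [h2]
  module

theorem commOp_eq_of_mul_eq_jordan (hρ : ρ.PosDef) {X Y : Matrix (Fin n) (Fin n) ℂ}
    (h : ρ * X = jordan ρ (X + Complex.I • Y)) : commOp ρ X = Y := by
  rw [mul_eq_jordan hρ] at h
  exact smul_right_injective _ Complex.I_ne_zero (add_left_cancel (jordan_injective hρ h))

/-- The commutation operator as a linear map. -/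
noncomputable def commLinearMap (hρ : ρ.PosDef) :
    Matrix (Fin n) (Fin n) ℂ →ₗ[ℝ] Matrix (Fin n) (Fin n) ℂ where
  toFun := commOp ρ
  map_add' X Y := by
    refine commOp_eq_of_mul_eq_jordan hρ ?_
    rw [Matrix.mul_add, mul_eq_jordan hρ, mul_eq_jordan hρ, ← map_add]
    congr 1
    module
  map_smul' c X := by
    refine commOp_eq_of_mul_eq_jordan hρ ?_
    rw [Matrix.mul_smul, mul_eq_jordan hρ, RingHom.id_apply, ← Complex.coe_smul,
      ← Complex.coe_smul, ← Complex.coe_smul, ← map_smul, smul_add, smul_comm Complex.I]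

theorem isHermitian_commOp (hρ : ρ.PosDef) {X : Matrix (Fin n) (Fin n) ℂ} (hX : X.IsHermitian) :
    (commOp ρ X).IsHermitian := by
  refine Eq.symm (commOp_eq_of_mul_eq_jordan hρ ?_)
  have h := commOp_spec hρ X
  have h' := congrArg Matrix.conjTranspose h
  simp only [Matrix.conjTranspose_add, Matrix.conjTranspose_smul, Matrix.conjTranspose_sub,
    Matrix.conjTranspose_mul, hX.eq, hρ.isHermitian.eq, Complex.star_def, Complex.conj_I] at h'
  rw [map_add, map_smul, jordan_apply, jordan_apply]
  have h2 : Complex.I • (1 / 2 : ℂ) • ((commOp ρ X).conjTranspose * ρ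
      + ρ * (commOp ρ X).conjTranspose) = (1 / 2 : ℂ) • (ρ * X - X * ρ) := by
    rw [← neg_sub (X * ρ), h']
    module
  rw [h2]
  module

/-- On Hermitian matrices the symmetric inner product is the real part of the right one. -/
theorem sldInner_re (hρ : ρ.IsHermitian) {X Y : Matrix (Fin n) (Fin n) ℂ} (hX : X.IsHermitian)
    (hY : Y.IsHermitian) : (sldInner ρ X Y).re = (rldInner ρ X Y).re := by
  have h := congrArg Complex.re (star_rldInner hρ X Y)
  simp only [rldInner, hX.eq, hY.eq] at h
  simp only [sldInner, rldInner, hX.eq, Matrix.mul_add, Matrix.trace_add, ← Matrix.mul_assoc]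
  simp at h ⊢
  rw [← h]
  ring

theorem trace_jordan_mul (hρ : ρ.IsHermitian) {L X : Matrix (Fin n) (Fin n) ℂ}
    (hL : L.IsHermitian) (hX : X.IsHermitian) :
    (jordan ρ L * X).trace = ((rldInner ρ L X).re : ℂ) := by
  have h := star_rldInner hρ L X
  have h1 : (L * ρ * X).trace = rldInner ρ L X := by
    rw [rldInner, hL.eq, Matrix.mul_assoc, Matrix.trace_mul_comm]
  have h2 : (ρ * L * X).trace = star (rldInner ρ L X) := by
    rw [h, rldInner, hX.eq]
  rw [jordan_apply, smul_mul_assoc, Matrix.trace_smul, Matrix.add_mul, Matrix.trace_add, h1, h2,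
    Complex.re_eq_add_conj, smul_eq_mul, Complex.star_def]
  ring

/-- On Hermitian matrices, the functional `X ↦ tr (A X)` is represented by the right logarithmic
derivative in the right inner product. -/
theorem rldInner_rldOf (hρ : ρ.PosDef) {X : Matrix (Fin n) (Fin n) ℂ} (hX : X.IsHermitian)
    (A : Matrix (Fin n) (Fin n) ℂ) : rldInner ρ X (rldOf ρ A) = (A * X).trace := by
  rw [rldInner, ← rldOf_spec hρ, hX.eq]

end Jordan

namespace Model

/-! ### Logarithmic derivatives of a model -/

section LogDerivatives

variable {n dI dN : ℕ} (M : Model n dI dN) {θ : Fin dI ⊕ Fin dN → ℝ}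

theorem isHermitian_dstate (hθ : θ ∈ M.Θ) (j : Fin dI ⊕ Fin dN) :
    (M.dstate θ j).IsHermitian := by
  ext a b
  have h1 : (fun η => M.state η a b) =ᶠ[nhds θ] fun η => star (M.state η b a) := by
    filter_upwards [M.isOpen.mem_nhds hθ] with η hη
    exact ((M.posDef η hη).isHermitian.apply a b).symm
  simp only [Matrix.conjTranspose_apply, dstate, partialDeriv, Matrix.of_apply]
  rw [h1.fderiv_eq, fderiv_star]
  rfl

theorem isHermitian_sld (hθ : θ ∈ M.Θ) (j : Fin dI ⊕ Fin dN) : (M.sld θ j).IsHermitian :=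
  sldOf_isHermitian (M.posDef θ hθ) (M.isHermitian_dstate hθ j)

theorem jordan_sld (hθ : θ ∈ M.Θ) (j : Fin dI ⊕ Fin dN) :
    jordan (M.state θ) (M.sld θ j) = M.dstate θ j :=
  jordan_sldOf (M.posDef θ hθ) _

theorem mul_rld (hθ : θ ∈ M.Θ) (j : Fin dI ⊕ Fin dN) :
    M.state θ * M.rld θ j = M.dstate θ j :=
  (rldOf_spec (M.posDef θ hθ) _).symm

theorem linearIndependent_sld (hθ : θ ∈ M.Θ) : LinearIndependent ℝ (M.sld θ) := by
  have h : LinearIndependent ℝ (M.dstate θ) := M.linearIndependent θ hθ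
  refine LinearIndependent.of_comp ((jordan (M.state θ)).restrictScalars ℝ) ?_
  convert h using 1
  exact funext fun j => M.jordan_sld hθ j

theorem linearIndependent_rld (hθ : θ ∈ M.Θ) : LinearIndependent ℂ (M.rld θ) := by
  have h : LinearIndependent ℂ (M.dstate θ) :=
    linearIndependent_complex (M.isHermitian_dstate hθ) (M.linearIndependent θ hθ)
  have hc : LinearMap.mulLeft ℂ (M.state θ) ∘ M.rld θ = M.dstate θ :=
    funext fun j => M.mul_rld hθ j
  exact LinearIndependent.of_comp (LinearMap.mulLeft ℂ (M.state θ)) (by rw [hc]; exact h)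

/-- The coefficients of the nuisance SLDs in the effective SLDs. -/
noncomputable def sldCoeff (θ : Fin dI ⊕ Fin dN → ℝ) : Matrix (Fin dI) (Fin dN) ℝ :=
  (M.sldFisher θ).toBlocks₁₂ * (M.sldFisher θ).toBlocks₂₂⁻¹

/-- The coefficients of the nuisance RLDs in the effective RLDs. -/
noncomputable def rldCoeff (θ : Fin dI ⊕ Fin dN → ℝ) : Matrix (Fin dI) (Fin dN) ℂ :=
  (M.rldFisher θ).toBlocks₁₂ * (M.rldFisher θ).toBlocks₂₂⁻¹

theorem effSLD_eq (θ : Fin dI ⊕ Fin dN → ℝ) :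
    M.effSLD θ = M.sld θ ∘ Sum.inl - combine (M.sldCoeff θ) (M.sld θ ∘ Sum.inr) := by
  ext1 i
  simp only [effSLD, Pi.sub_apply, Function.comp_apply, combine, sldCoeff, Matrix.mul_apply,
    Finset.sum_smul]
  rw [Finset.sum_comm]
  rfl

theorem effRLD_eq (θ : Fin dI ⊕ Fin dN → ℝ) :
    M.effRLD θ = M.rld θ ∘ Sum.inl - combine (M.rldCoeff θ) (M.rld θ ∘ Sum.inr) := by
  ext1 i
  simp only [effRLD, Pi.sub_apply, Function.comp_apply, combine, rldCoeff, Matrix.mul_apply,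
    Finset.sum_smul]
  rw [Finset.sum_comm]
  rfl

theorem sldFisher_toBlocks₁₂ (hθ : θ ∈ M.Θ) : (M.sldFisher θ).toBlocks₁₂ =
    (crossGram (M.state θ) (M.sld θ ∘ Sum.inl) (M.sld θ ∘ Sum.inr)).map Complex.re := by
  ext i j
  exact sldInner_re (M.posDef θ hθ).isHermitian (M.isHermitian_sld hθ _) (M.isHermitian_sld hθ _)

theorem sldFisher_toBlocks₂₂ (hθ : θ ∈ M.Θ) : (M.sldFisher θ).toBlocks₂₂ =
    (crossGram (M.state θ) (M.sld θ ∘ Sum.inr) (M.sld θ ∘ Sum.inr)).map Complex.re := by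
  ext i j
  exact sldInner_re (M.posDef θ hθ).isHermitian (M.isHermitian_sld hθ _) (M.isHermitian_sld hθ _)

theorem isUnit_det_sldFisher (hθ : θ ∈ M.Θ) : IsUnit (M.sldFisher θ).toBlocks₂₂.det := by
  rw [M.sldFisher_toBlocks₂₂ hθ, ← Matrix.isUnit_iff_isUnit_det]
  exact (posDef_crossGram_re (M.posDef θ hθ)
    ((M.linearIndependent_sld hθ).comp _ Sum.inr_injective)).isUnit

theorem rldFisher_toBlocks₁₂ : (M.rldFisher θ).toBlocks₁₂ =
    crossGram (M.state θ) (M.rld θ ∘ Sum.inl) (M.rld θ ∘ Sum.inr) := rfl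

theorem rldFisher_toBlocks₂₂ : (M.rldFisher θ).toBlocks₂₂ =
    crossGram (M.state θ) (M.rld θ ∘ Sum.inr) (M.rld θ ∘ Sum.inr) := rfl

theorem isUnit_det_rldFisher (hθ : θ ∈ M.Θ) : IsUnit (M.rldFisher θ).toBlocks₂₂.det := by
  rw [M.rldFisher_toBlocks₂₂, ← Matrix.isUnit_iff_isUnit_det]
  exact (posDef_crossGram (M.posDef θ hθ)
    ((M.linearIndependent_rld hθ).comp _ Sum.inr_injective)).isUnit

theorem isHermitian_effSLD (hθ : θ ∈ M.Θ) (i : Fin dI) : (M.effSLD θ i).IsHermitian := by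
  rw [M.effSLD_eq]
  exact (M.isHermitian_sld hθ _).sub (isHermitian_combine _ (fun k => M.isHermitian_sld hθ _) i)

theorem linearIndependent_effSLD (hθ : θ ∈ M.Θ) : LinearIndependent ℝ (M.effSLD θ) := by
  have h := M.linearIndependent_sld hθ
  rw [Fintype.linearIndependent_iff] at h ⊢
  intro v hv i
  refine h (Sum.elim v fun k => -∑ i, v i * M.sldCoeff θ i k) ?_ (Sum.inl i)
  rw [← hv, M.effSLD_eq]
  simp only [Fintype.sum_sum_type, Sum.elim_inl, Sum.elim_inr, Pi.sub_apply, Function.comp_apply,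
    combine, smul_sub, Finset.sum_sub_distrib, Finset.smul_sum, smul_smul, neg_smul,
    Finset.sum_smul, Finset.sum_neg_distrib]
  rw [Finset.sum_comm (f := fun k i => (v i * M.sldCoeff θ i k) • M.sld θ (Sum.inr k)),
    sub_eq_add_neg]

/-- On Hermitian matrices, the functionals `X ↦ tr (∂_j ρ X)` of the unbiasedness condition are
represented by the SLDs in the symmetric inner product. -/
theorem crossGram_sld_re_apply (hθ : θ ∈ M.Θ) {ι : Type*} {X : ι → Matrix (Fin n) (Fin n) ℂ}
    (hX : ∀ i, (X i).IsHermitian) (j : Fin dI ⊕ Fin dN) (i : ι) :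
    (((crossGram (M.state θ) (M.sld θ) X).map Complex.re j i : ℝ) : ℂ)
      = (M.dstate θ j * X i).trace := by
  rw [← M.jordan_sld hθ, trace_jordan_mul (M.posDef θ hθ).isHermitian (M.isHermitian_sld hθ j)
    (hX i)]
  rfl

theorem crossGram_effSLD_nuisance (hθ : θ ∈ M.Θ) :
    (crossGram (M.state θ) (M.effSLD θ) (M.sld θ ∘ Sum.inr)).map Complex.re = 0 := by
  rw [M.effSLD_eq, crossGram_sub_left_re, crossGram_re_combine_left, ← M.sldFisher_toBlocks₁₂ hθ,
    ← M.sldFisher_toBlocks₂₂ hθ, sldCoeff,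
    Matrix.nonsing_inv_mul_cancel_right _ _ (M.isUnit_det_sldFisher hθ), sub_self]

/-- The partial SLD Fisher information matrix, the Gram matrix of the effective SLDs. -/
noncomputable def partialSLDFisher (θ : Fin dI ⊕ Fin dN → ℝ) : Matrix (Fin dI) (Fin dI) ℝ :=
  (crossGram (M.state θ) (M.effSLD θ) (M.effSLD θ)).map Complex.re

theorem posDef_partialSLDFisher (hθ : θ ∈ M.Θ) : (M.partialSLDFisher θ).PosDef :=
  posDef_crossGram_re (M.posDef θ hθ) (M.linearIndependent_effSLD hθ)

theorem isUnit_det_partialSLDFisher (hθ : θ ∈ M.Θ) : IsUnit (M.partialSLDFisher θ).det :=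
  (Matrix.isUnit_iff_isUnit_det _).1 (M.posDef_partialSLDFisher hθ).isUnit

/-- The basis of the span of the effective SLDs that is dual to the SLDs of interest: the
locally unbiased estimators that are optimal for the SLD bound. -/
noncomputable def dualSLD (θ : Fin dI ⊕ Fin dN → ℝ) : Fin dI → Matrix (Fin n) (Fin n) ℂ :=
  combine (M.partialSLDFisher θ)⁻¹ (M.effSLD θ)

theorem isHermitian_dualSLD (hθ : θ ∈ M.Θ) (i : Fin dI) : (M.dualSLD θ i).IsHermitian :=
  isHermitian_combine _ (M.isHermitian_effSLD hθ) i

theorem effSLD_eq_combine_dualSLD (hθ : θ ∈ M.Θ) :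
    M.effSLD θ = combine (M.partialSLDFisher θ) (M.dualSLD θ) := by
  rw [dualSLD, ← combine_mul, Matrix.mul_nonsing_inv _ (M.isUnit_det_partialSLDFisher hθ),
    combine_one]

theorem transpose_partialSLDFisher_inv (hθ : θ ∈ M.Θ) :
    (M.partialSLDFisher θ)⁻¹.transpose = (M.partialSLDFisher θ)⁻¹ := by
  simpa [Matrix.IsSymm] using (M.posDef_partialSLDFisher hθ).inv.isHermitian

theorem feasible_dualSLD (hθ : θ ∈ M.Θ) : M.Feasible θ (M.dualSLD θ) := by
  have hρ := (M.posDef θ hθ).isHermitian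
  refine ⟨M.isHermitian_dualSLD hθ, fun i j => ?_⟩
  rw [← M.crossGram_sld_re_apply hθ (M.isHermitian_dualSLD hθ)]
  have hN : (crossGram (M.state θ) (M.sld θ ∘ Sum.inr) (M.dualSLD θ)).map Complex.re = 0 := by
    rw [dualSLD, crossGram_re_combine_right, ← transpose_crossGram_re hρ,
      M.crossGram_effSLD_nuisance hθ]
    simp
  have hI : (crossGram (M.state θ) (M.sld θ ∘ Sum.inl) (M.dualSLD θ)).map Complex.re = 1 := by
    have h1 : (crossGram (M.state θ) (M.effSLD θ) (M.dualSLD θ)).map Complex.re = 1 := by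
      rw [dualSLD, crossGram_re_combine_right, M.transpose_partialSLDFisher_inv hθ]
      exact Matrix.mul_nonsing_inv _ (M.isUnit_det_partialSLDFisher hθ)
    rw [M.effSLD_eq, crossGram_sub_left_re, crossGram_re_combine_left, hN, Matrix.mul_zero,
      sub_zero] at h1
    exact h1
  rcases j with j | k
  · have := congrFun (congrFun hI j) i
    change (crossGram (M.state θ) (M.sld θ) (M.dualSLD θ)).map Complex.re (Sum.inl j) i = _ at this
    rw [this]
    simp [Matrix.one_apply, eq_comm, apply_ite]
  · have := congrFun (congrFun hN k) i
    change (crossGram (M.state θ) (M.sld θ) (M.dualSLD θ)).map Complex.re (Sum.inr k) i = _ at this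
    rw [this]
    simp

theorem zMatrix_eq_crossGram {X : Fin dI → Matrix (Fin n) (Fin n) ℂ}
    (hX : ∀ i, (X i).IsHermitian) : M.zMatrix θ X = crossGram (M.state θ) X X := by
  ext i j
  rw [zMatrix, crossGram, Matrix.of_apply, Matrix.of_apply, rldInner, (hX i).eq, Matrix.mul_assoc,
    Matrix.trace_mul_comm]

theorem zMatrix_dualSLD_re (hθ : θ ∈ M.Θ) :
    (M.zMatrix θ (M.dualSLD θ)).map Complex.re = (M.partialSLDFisher θ)⁻¹ := by
  rw [M.zMatrix_eq_crossGram (M.isHermitian_dualSLD hθ), dualSLD, crossGram_re_combine_right,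
    crossGram_re_combine_left, M.transpose_partialSLDFisher_inv hθ]
  rw [← partialSLDFisher, Matrix.nonsing_inv_mul _ (M.isUnit_det_partialSLDFisher hθ), one_mul]

end LogDerivatives

end Model

/-! ### Attainment of the Holevo bound -/

section Attainment

/-- The sublevel sets of a continuous positive definite quadratic function on a
finite-dimensional space are compact. -/
theorem isCompact_sublevel_of_homogeneous {E : Type*} [NormedAddCommGroup E] [NormedSpace ℝ E]
    [FiniteDimensional ℝ E] {q : E → ℝ} (hq : Continuous q)
    (hom : ∀ (t : ℝ) x, q (t • x) = t ^ 2 * q x) (hpos : ∀ x, x ≠ 0 → 0 < q x) (C : ℝ) :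
    IsCompact {x | q x ≤ C} := by
  have : ProperSpace E := FiniteDimensional.proper ℝ E
  obtain ⟨c, hc, hcq⟩ : ∃ c : ℝ, 0 < c ∧ ∀ x, c * ‖x‖ ^ 2 ≤ q x := by
    rcases subsingleton_or_nontrivial E with hE | hE
    · refine ⟨1, one_pos, fun x => ?_⟩
      have h0 := hom 0 x
      rw [Subsingleton.elim x 0] at h0 ⊢
      simp at h0
      simp [h0]
    · obtain ⟨x₀, hx₀, hmin⟩ := (isCompact_sphere (0 : E) 1).exists_isMinOn
        (NormedSpace.sphere_nonempty.2 zero_le_one) hq.continuousOn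
      have hx₀1 : ‖x₀‖ = 1 := by simpa using hx₀
      refine ⟨q x₀, hpos x₀ (norm_ne_zero_iff.1 (by rw [hx₀1]; exact one_ne_zero)), fun x => ?_⟩
      by_cases hx : x = 0
      · have h0 := hom 0 x
        rw [hx] at h0 ⊢
        simp at h0
        simp [h0]
      · have hn : ‖x‖ ≠ 0 := norm_ne_zero_iff.2 hx
        have hmem : ‖x‖⁻¹ • x ∈ Metric.sphere (0 : E) 1 := by
          simp [norm_smul, hn]
        have h1 : q x₀ ≤ q (‖x‖⁻¹ • x) := hmin hmem
        have h2 := hom ‖x‖ (‖x‖⁻¹ • x)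
        rw [smul_smul, mul_inv_cancel₀ hn, one_smul] at h2
        rw [h2, mul_comm]
        exact mul_le_mul_of_nonneg_left h1 (sq_nonneg _)
  refine Metric.isCompact_of_isClosed_isBounded (isClosed_le hq continuous_const) ?_
  refine (Metric.isBounded_closedBall (x := (0 : E)) (r := C / c + 1)).subset fun x hx => ?_
  have h1 : ‖x‖ ^ 2 ≤ C / c := by
    rw [le_div_iff₀ hc, mul_comm]
    exact (hcq x).trans hx
  rw [mem_closedBall_zero_iff]
  nlinarith [sq_nonneg (‖x‖ - 1), norm_nonneg x]

variable {n dI dN : ℕ}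

theorem continuous_crossGram {ι : Type*} (ρ : Matrix (Fin n) (Fin n) ℂ) :
    Continuous fun X : ι → Matrix (Fin n) (Fin n) ℂ => crossGram ρ X X := by
  refine continuous_matrix fun i j => ?_
  have hi : Continuous fun X : ι → Matrix (Fin n) (Fin n) ℂ => X i := continuous_apply i
  exact ((continuous_const.matrix_mul (continuous_apply j)).matrix_mul
    hi.matrix_conjTranspose).matrix_trace

theorem isCompact_trace_mul_crossGram_le {ρ : Matrix (Fin n) (Fin n) ℂ} (hρ : ρ.PosDef)
    {W : Matrix (Fin dI) (Fin dI) ℝ} (hW : W.PosDef) (C : ℝ) :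
    IsCompact {X : Fin dI → Matrix (Fin n) (Fin n) ℂ |
      (W * (crossGram ρ X X).map Complex.re).trace ≤ C} := by
  let _ : NormedAddCommGroup (Matrix (Fin n) (Fin n) ℂ) := Matrix.normedAddCommGroup
  let _ : NormedSpace ℝ (Matrix (Fin n) (Fin n) ℂ) := Matrix.normedSpace
  refine isCompact_sublevel_of_homogeneous
    (q := fun X => (W * (crossGram ρ X X).map Complex.re).trace) ?_ ?_ ?_ C
  · exact (continuous_const.matrix_mul
      ((continuous_crossGram ρ).matrix_map Complex.continuous_re)).matrix_trace
  · intro t X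
    have h : (crossGram ρ (t • X) (t • X)).map Complex.re
        = t ^ 2 • (crossGram ρ X X).map Complex.re := by
      ext i j
      simp [crossGram, rldInner, Matrix.trace_smul, smul_smul, sq, mul_assoc]
    simp only [h, Matrix.mul_smul, Matrix.trace_smul, smul_eq_mul]
  · intro X hX
    have hG := posSemidef_crossGram_re hρ.posSemidef X
    refine lt_of_le_of_ne (trace_mul_nonneg_of_posSemidef hW.posSemidef hG) fun h => hX ?_
    have h0 := eq_zero_of_trace_mul_eq_zero hW hG h.symm
    ext1 i
    exact eq_zero_of_rldInner_self hρ (Complex.ext (congrFun (congrFun h0 i) i)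
      (Complex.nonneg_iff.1 (rldInner_self_nonneg hρ.posSemidef (X i))).2.symm)

namespace Model

variable (M : Model n dI dN) {θ : Fin dI ⊕ Fin dN → ℝ}

theorem isClosed_feasible : IsClosed {X | M.Feasible θ X} := by
  simp only [Feasible, Set.ofPred_and, Set.ofPred_forall]
  refine (isClosed_iInter fun i => ?_).inter
    (isClosed_iInter fun i => isClosed_iInter fun j => ?_)
  · exact isClosed_eq (continuous_apply i).matrix_conjTranspose (continuous_apply i)
  · exact isClosed_eq (continuous_const.matrix_mul (continuous_apply i)).matrix_trace
      continuous_const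

theorem lowerSemicontinuousOn_weightedBound (hθ : θ ∈ M.Θ) (W : Matrix (Fin dI) (Fin dI) ℝ)
    (s : Set (Fin dI → Matrix (Fin n) (Fin n) ℂ)) :
    LowerSemicontinuousOn (fun X => weightedBound W (crossGram (M.state θ) X X)) s := by
  intro X _ y hy
  obtain ⟨T, hT, hyT⟩ := exists_lt_testValue
    (conjTranspose_crossGram (M.posDef θ hθ).isHermitian X X) hy
  have hc : Continuous fun X => testValue W T (crossGram (M.state θ) X X) :=
    (continuous_testValue W T).comp (continuous_crossGram _)
  filter_upwards [mem_nhdsWithin_of_mem_nhds (hc.continuousAt.eventually_const_lt hyT)] with X' hX'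
  exact lt_of_lt_of_le hX' (testValue_le_weightedBound hT _)

/-- The minimum exists: the objective is lower semicontinuous and dominates the positive definite
quadratic function `Tr (W Re Z(X))`, so its sublevel sets are compact. -/
theorem isLeast_holevoBound (hθ : θ ∈ M.Θ) {W : Matrix (Fin dI) (Fin dI) ℝ} (hW : W.PosDef) :
    IsLeast (M.holevoValues θ W) (M.holevoBound θ W) := by
  -- The infimum in `holevoBound` agrees with any least element.
  suffices h : ∃ c, IsLeast (M.holevoValues θ W) c by
    obtain ⟨c, hc⟩ := h
    rw [holevoBound, hc.csInf_eq]
    exact hc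
  set f := fun X => weightedBound W (crossGram (M.state θ) X X) with hf
  have hcomp := (isCompact_trace_mul_crossGram_le (M.posDef θ hθ) hW (f (M.dualSLD θ))).inter_left
    (M.isClosed_feasible (θ := θ))
  have hmem : M.dualSLD θ ∈ {X | M.Feasible θ X} ∩ {X |
      (W * (crossGram (M.state θ) X X).map Complex.re).trace ≤ f (M.dualSLD θ)} :=
    ⟨M.feasible_dualSLD hθ, trace_mul_re_le_weightedBound _ _⟩
  obtain ⟨X, hX, hmin⟩ := LowerSemicontinuousOn.exists_isMinOn ⟨_, hmem⟩ hcomp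
    (M.lowerSemicontinuousOn_weightedBound hθ W _)
  refine ⟨f X, ⟨X, hX.1, by rw [M.zMatrix_eq_crossGram hX.1.1]⟩, ?_⟩
  rintro _ ⟨Y, hY, rfl⟩
  rw [M.zMatrix_eq_crossGram hY.1]
  rcases le_total (W * (crossGram (M.state θ) Y Y).map Complex.re).trace (f (M.dualSLD θ))
    with h | h
  · exact hmin ⟨hY, h⟩
  · exact (hmin hmem).trans (h.trans (trace_mul_re_le_weightedBound _ _))

/-! ### D-invariance as an equality of matrices -/

theorem crossGram_rld_of_feasible (hθ : θ ∈ M.Θ) {X : Fin dI → Matrix (Fin n) (Fin n) ℂ}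
    (hX : M.Feasible θ X) :
    crossGram (M.state θ) X (M.rld θ ∘ Sum.inl) = 1 ∧
      crossGram (M.state θ) X (M.rld θ ∘ Sum.inr) = 0 := by
  constructor
  · ext i j
    have h := rldInner_rldOf (M.posDef θ hθ) (hX.1 i) (M.dstate θ (Sum.inl j))
    rw [hX.2] at h
    exact h.trans (by simp [Matrix.one_apply])
  · ext i j
    have h := rldInner_rldOf (M.posDef θ hθ) (hX.1 i) (M.dstate θ (Sum.inr j))
    rw [hX.2] at h
    exact h.trans (by simp)

/-- Locally unbiased estimators are dual to the RLDs of interest corrected by any combinations of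
the nuisance RLDs. -/
theorem crossGram_rld_sub_combine (hθ : θ ∈ M.Θ) {X : Fin dI → Matrix (Fin n) (Fin n) ℂ}
    (hX : M.Feasible θ X) (D : Matrix (Fin dI) (Fin dN) ℂ) :
    crossGram (M.state θ) X (M.rld θ ∘ Sum.inl - combine D (M.rld θ ∘ Sum.inr)) = 1 := by
  obtain ⟨h1, h2⟩ := M.crossGram_rld_of_feasible hθ hX
  rw [crossGram_sub_right, crossGram_combine_right, h1, h2, Matrix.zero_mul, sub_zero]

theorem crossGram_effRLD (hθ : θ ∈ M.Θ) {X : Fin dI → Matrix (Fin n) (Fin n) ℂ}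
    (hX : M.Feasible θ X) : crossGram (M.state θ) X (M.effRLD θ) = 1 := by
  rw [M.effRLD_eq]
  exact M.crossGram_rld_sub_combine hθ hX _

/-- The RLD Cramér–Rao inequality in matrix form. -/
theorem posSemidef_zMatrix_sub (hθ : θ ∈ M.Θ) {X : Fin dI → Matrix (Fin n) (Fin n) ℂ}
    (hX : M.Feasible θ X) : (M.zMatrix θ X - (M.partialRLDFisher θ)⁻¹).PosSemidef := by
  rw [M.zMatrix_eq_crossGram hX.1]
  exact posSemidef_crossGram_sub_inv (M.posDef θ hθ) (M.crossGram_effRLD hθ hX)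

theorem posDef_partialRLDFisher (hθ : θ ∈ M.Θ) : (M.partialRLDFisher θ).PosDef :=
  posDef_crossGram (M.posDef θ hθ)
    (linearIndependent_of_crossGram_eq_one (M.crossGram_effRLD hθ (M.feasible_dualSLD hθ)))

theorem crossGram_rld_residual_nuisance (D : Matrix (Fin dI) (Fin dN) ℂ) :
    crossGram (M.state θ) (M.rld θ ∘ Sum.inl - combine D (M.rld θ ∘ Sum.inr)) (M.rld θ ∘ Sum.inr)
      = (M.rldFisher θ).toBlocks₁₂ - D.map star * (M.rldFisher θ).toBlocks₂₂ := by
  rw [crossGram_sub_left, crossGram_combine_left, M.rldFisher_toBlocks₁₂, M.rldFisher_toBlocks₂₂]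

/-- The orthogonality to the nuisance RLDs determines the coefficients, up to the complex
conjugation that separates `rldCoeff` from the coefficients of the orthogonal projection. -/
theorem rldCoeff_eq_of_crossGram_eq_zero (hθ : θ ∈ M.Θ) {D : Matrix (Fin dI) (Fin dN) ℂ}
    (h : crossGram (M.state θ) (M.rld θ ∘ Sum.inl - combine D (M.rld θ ∘ Sum.inr))
      (M.rld θ ∘ Sum.inr) = 0) : M.rldCoeff θ = D.map star := by
  rw [M.crossGram_rld_residual_nuisance, sub_eq_zero] at h
  rw [rldCoeff, h, Matrix.mul_nonsing_inv_cancel_right _ _ (M.isUnit_det_rldFisher hθ)]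

/-- Real corrections of RLDs and SLDs correspond: both represent the same combinations of the
partial derivatives of the state. -/
theorem mul_rld_residual (hθ : θ ∈ M.Θ) (c : Matrix (Fin dI) (Fin dN) ℝ) (i : Fin dI) :
    M.state θ * (M.rld θ ∘ Sum.inl - combine (c.map Complex.ofReal) (M.rld θ ∘ Sum.inr)) i =
      jordan (M.state θ) ((M.sld θ ∘ Sum.inl - combine c (M.sld θ ∘ Sum.inr)) i) := by
  rw [← combine_ofReal, Pi.sub_apply, Pi.sub_apply, map_sub, map_combine, Matrix.mul_sub]
  have h := map_combine (LinearMap.mulLeft ℂ (M.state θ)) (c.map Complex.ofReal)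
    (M.rld θ ∘ Sum.inr) i
  simp only [LinearMap.mulLeft_apply] at h
  rw [h]
  simp only [Function.comp_apply, M.mul_rld hθ, M.jordan_sld hθ]

/-- Under D-invariance left multiplication by `ρ` turns each dual SLD into a complex combination of
the derivatives of the state corrected with the real SLD coefficients. So the dual SLDs lie in the
span of the correspondingly corrected RLDs, which unbiasedness then identifies as the effective
RLDs. -/
theorem zMatrix_dualSLD_eq_of_dInvariantAt (hθ : θ ∈ M.Θ) (h : M.DInvariantAt θ) :
    M.zMatrix θ (M.dualSLD θ) = (M.partialRLDFisher θ)⁻¹ := by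
  have hρ := M.posDef θ hθ
  have hX := M.feasible_dualSLD hθ
  set X := M.dualSLD θ with hXdef
  -- `T` are the RLD residuals with the real coefficients of the SLD case.
  set T := M.rld θ ∘ Sum.inl - combine ((M.sldCoeff θ).map Complex.ofReal) (M.rld θ ∘ Sum.inr)
    with hT
  obtain ⟨F, hF⟩ : ∃ F : Matrix (Fin dI) (Fin dI) ℂ, X = combine F T := by
    have h' : ∀ i, ∃ c : Fin dI → ℝ, ∑ j, c j • M.effSLD θ j = commOp (M.state θ) (M.effSLD θ i) :=
      fun i => (Submodule.mem_span_range_iff_exists_fun ℝ).1 (h i)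
    choose d hd using h'
    let E : Matrix (Fin dI) (Fin dI) ℂ :=
      1 + Complex.I • (Matrix.of d).map Complex.ofReal
    have hE : M.effSLD θ = combine E T := by
      ext1 i
      have h1 : M.effSLD θ i + Complex.I • commOp (M.state θ) (M.effSLD θ i)
          = combine E (M.effSLD θ) i := by
        simp only [combine, E, Matrix.add_apply, add_smul, Finset.sum_add_distrib, ← hd,
          Matrix.smul_apply, smul_eq_mul, mul_smul, ← Finset.smul_sum, Matrix.map_apply,
          Matrix.of_apply, Complex.coe_smul]
        simp [Matrix.one_apply]
      have h2 : M.state θ * M.effSLD θ i = M.state θ * combine E T i := by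
        have h3 := map_combine (LinearMap.mulLeft ℂ (M.state θ)) E T i
        simp only [LinearMap.mulLeft_apply] at h3
        rw [mul_eq_jordan hρ, h1, map_combine, h3]
        simp only [hT, M.mul_rld_residual hθ, ← M.effSLD_eq]
      exact hρ.isUnit.mul_left_cancel h2
    refine ⟨(M.partialSLDFisher θ)⁻¹.map Complex.ofReal * E, ?_⟩
    rw [combine_mul, ← hE, combine_ofReal, hXdef, dualSLD]
  -- Duality of `X` and `T` makes `F` invertible, so `T`, like `X`, is orthogonal to the nuisance RLDs.
  have hXT : crossGram (M.state θ) X T = 1 := M.crossGram_rld_sub_combine hθ hX _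
  have hFT : F.map star * crossGram (M.state θ) T T = 1 := by
    rw [← crossGram_combine_left, ← hF, hXT]
  have hTN : crossGram (M.state θ) T (M.rld θ ∘ Sum.inr) = 0 := by
    have h1 := (M.crossGram_rld_of_feasible hθ hX).2
    rw [hF, crossGram_combine_left] at h1
    rw [← Matrix.one_mul (crossGram (M.state θ) T (M.rld θ ∘ Sum.inr)), ← mul_eq_one_comm.1 hFT,
      Matrix.mul_assoc, h1, Matrix.mul_zero]
  have hTe : T = M.effRLD θ := by
    rw [M.effRLD_eq, M.rldCoeff_eq_of_crossGram_eq_zero hθ hTN, hT]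
    congr 2
    ext i k
    simp
  have hG : F.map star = (M.partialRLDFisher θ)⁻¹ := by
    rw [hTe] at hFT
    exact (Matrix.inv_eq_left_inv hFT).symm
  have hFt : F.transpose = (M.partialRLDFisher θ)⁻¹ := by
    have h1 : F.transpose = (F.map star).conjTranspose := by
      ext i j
      simp
    rw [h1, hG, (M.posDef_partialRLDFisher hθ).inv.isHermitian.eq]
  rw [M.zMatrix_eq_crossGram hX.1, ← hFt]
  nth_rewrite 2 [hF]
  rw [crossGram_combine_right, hXT, Matrix.one_mul]

/-- Equality in the RLD Cramér–Rao inequality puts the dual SLDs `X` into the complex span of the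
effective RLDs; the real and imaginary parts of that expansion express `X` and `𝒟 X` through the
effective SLDs. -/
theorem dInvariantAt_of_zMatrix_dualSLD_eq (hθ : θ ∈ M.Θ)
    (h : M.zMatrix θ (M.dualSLD θ) = (M.partialRLDFisher θ)⁻¹) : M.DInvariantAt θ := by
  have hρ := M.posDef θ hθ
  have hX := M.feasible_dualSLD hθ
  have hre := M.zMatrix_dualSLD_re hθ
  have hG := M.posDef_partialRLDFisher hθ
  have hdet : IsUnit (M.partialRLDFisher θ).det :=
    (Matrix.isUnit_iff_isUnit_det _).1 hG.isUnit
  set X := M.dualSLD θ with hXdef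
  set F := (M.partialRLDFisher θ)⁻¹.transpose with hF
  have hXF : X = combine F (M.effRLD θ) :=
    eq_combine_of_crossGram_eq_inv hρ (M.crossGram_effRLD hθ hX)
      (by rw [← M.zMatrix_eq_crossGram hX.1, h]; rfl)
  -- Unbiasedness makes the effective RLDs orthogonal to the nuisance RLDs, so their
  -- coefficients are real.
  have hN : crossGram (M.state θ) (M.effRLD θ) (M.rld θ ∘ Sum.inr) = 0 := by
    have h1 := (M.crossGram_rld_of_feasible hθ hX).2
    have hs : F.map star = (M.partialRLDFisher θ)⁻¹ := hG.inv.isHermitian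
    rw [hXF, crossGram_combine_left, hs] at h1
    have h2 := congrArg (fun A => M.partialRLDFisher θ * A) h1
    simpa [← Matrix.mul_assoc, Matrix.mul_nonsing_inv _ hdet] using h2
  obtain ⟨c, hc⟩ : ∃ c : Matrix (Fin dI) (Fin dN) ℝ, M.rldCoeff θ = c.map Complex.ofReal := by
    refine ⟨(M.rldCoeff θ).map Complex.re, ?_⟩
    rw [M.effRLD_eq] at hN
    have h1 := M.rldCoeff_eq_of_crossGram_eq_zero hθ hN
    ext i k
    have h2 := congrFun (congrFun h1 i) k
    exact (Complex.conj_eq_iff_re.1 h2.symm).symm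
  set Q := M.sld θ ∘ Sum.inl - combine c (M.sld θ ∘ Sum.inr) with hQ
  have hQh : ∀ i, (Q i).IsHermitian := fun i =>
    (M.isHermitian_sld hθ _).sub (isHermitian_combine _ (fun k => M.isHermitian_sld hθ _) i)
  have hparts : ∀ i, X i = combine (F.map Complex.re) Q i ∧
      commOp (M.state θ) (X i) = combine (F.map Complex.im) Q i := by
    intro i
    refine add_I_smul_inj (hX.1 i) (isHermitian_combine _ hQh i) (isHermitian_commOp hρ (hX.1 i))
      (isHermitian_combine _ hQh i) ?_
    rw [← combine_eq_re_add_im]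
    refine jordan_injective hρ ?_
    have h3 := map_combine (LinearMap.mulLeft ℂ (M.state θ)) F (M.effRLD θ) i
    simp only [LinearMap.mulLeft_apply] at h3
    rw [← mul_eq_jordan hρ, map_combine, hXF, h3]
    simp only [M.effRLD_eq, hc, M.mul_rld_residual hθ, hQ]
  -- The real part of `F` is the inverse of the partial SLD Fisher information.
  have hFre : F.map Complex.re = (M.partialSLDFisher θ)⁻¹ := by
    rw [← M.transpose_partialSLDFisher_inv hθ, ← hre, h, hF]
    rfl
  have hQe : Q = M.effSLD θ := by
    rw [M.effSLD_eq_combine_dualSLD hθ, ← hXdef, funext fun i => (hparts i).1, hFre,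
      ← combine_mul, Matrix.mul_nonsing_inv _ (M.isUnit_det_partialSLDFisher hθ), combine_one]
  intro i
  have h4 : commOp (M.state θ) (M.effSLD θ i)
      = combine (M.partialSLDFisher θ) (fun k => commOp (M.state θ) (X k)) i := by
    rw [M.effSLD_eq_combine_dualSLD hθ]
    exact map_combine (commLinearMap hρ) _ X i
  rw [h4, funext fun k => (hparts k).2, ← combine_mul, hQe]
  exact Submodule.sum_mem _ fun j _ =>
    Submodule.smul_mem _ _ (Submodule.subset_span (Set.mem_range_self j))

/-! ### Comparison of the bounds -/

/-- The SLD bound: among the locally unbiased estimators, the dual SLD basis has the smallest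
real covariance. -/
theorem trace_mul_zMatrix_dualSLD_re_le (hθ : θ ∈ M.Θ) {W : Matrix (Fin dI) (Fin dI) ℝ}
    (hW : W.PosSemidef) {X : Fin dI → Matrix (Fin n) (Fin n) ℂ} (hX : M.Feasible θ X) :
    (W * (M.zMatrix θ (M.dualSLD θ)).map Complex.re).trace
      ≤ (W * (M.zMatrix θ X).map Complex.re).trace := by
  have hρ := M.posDef θ hθ
  have h0 := M.feasible_dualSLD hθ
  rw [M.zMatrix_eq_crossGram hX.1, M.zMatrix_eq_crossGram h0.1]
  set X₀ := M.dualSLD θ with hX₀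
  set Y := X - X₀ with hY
  have hYh : ∀ i, (Y i).IsHermitian := fun i => (hX.1 i).sub (h0.1 i)
  have hsld : (crossGram (M.state θ) (M.sld θ) Y).map Complex.re = 0 := by
    ext j i
    have h1 := M.crossGram_sld_re_apply hθ hYh j i
    rw [hY, Pi.sub_apply, Matrix.mul_sub, Matrix.trace_sub, hX.2, h0.2, sub_self] at h1
    exact_mod_cast h1
  have hX₀Y : (crossGram (M.state θ) X₀ Y).map Complex.re = 0 := by
    have hI : (crossGram (M.state θ) (M.sld θ ∘ Sum.inl) Y).map Complex.re = 0 := by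
      ext j i
      exact congrFun (congrFun hsld (Sum.inl j)) i
    have hN : (crossGram (M.state θ) (M.sld θ ∘ Sum.inr) Y).map Complex.re = 0 := by
      ext j i
      exact congrFun (congrFun hsld (Sum.inr j)) i
    rw [hX₀, dualSLD, crossGram_re_combine_left, M.effSLD_eq, crossGram_sub_left_re,
      crossGram_re_combine_left, hI, hN]
    simp
  have hYX₀ : (crossGram (M.state θ) Y X₀).map Complex.re = 0 := by
    rw [← transpose_crossGram_re hρ.isHermitian, hX₀Y, Matrix.transpose_zero]
  have hYY : (crossGram (M.state θ) Y Y).map Complex.re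
      = (crossGram (M.state θ) X X).map Complex.re
        - (crossGram (M.state θ) X₀ X₀).map Complex.re := by
    have h1 := crossGram_sub_left_re (ρ := M.state θ) X X₀ Y
    have h2 := crossGram_sub_right_re (ρ := M.state θ) X X X₀
    have h3 := crossGram_sub_left_re (ρ := M.state θ) X X₀ X₀
    rw [← hY] at h1 h2 h3
    rw [h1, h2, hX₀Y, sub_zero, ← sub_eq_zero.1 (h3.symm.trans hYX₀)]
  have h := trace_mul_nonneg_of_posSemidef hW (posSemidef_crossGram_re hρ.posSemidef Y)
  rw [hYY, Matrix.mul_sub, Matrix.trace_sub] at h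
  linarith

theorem holevoBound_eq_rldBound (hθ : θ ∈ M.Θ)
    (h : M.zMatrix θ (M.dualSLD θ) = (M.partialRLDFisher θ)⁻¹)
    {W : Matrix (Fin dI) (Fin dI) ℝ} (hW : W.PosDef) : M.holevoBound θ W = M.rldBound θ W := by
  refine (M.isLeast_holevoBound hθ hW).unique
    ⟨⟨M.dualSLD θ, M.feasible_dualSLD hθ, by rw [h, rldBound]⟩, ?_⟩
  rintro _ ⟨X, hX, rfl⟩
  exact weightedBound_mono hW.posSemidef (M.posDef_partialRLDFisher hθ).inv.isHermitian
    (M.posSemidef_zMatrix_sub hθ hX)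

/-- If the bounds agree, the SLD bound `Tr (W Re Z)` of the dual SLDs lies below the RLD bound for
all weights, and nearly rank-one weights force equality in the RLD Cramér–Rao inequality. -/
theorem zMatrix_dualSLD_eq_of_holevoBound_eq (hθ : θ ∈ M.Θ)
    (h : ∀ W : Matrix (Fin dI) (Fin dI) ℝ, W.PosDef → M.holevoBound θ W = M.rldBound θ W) :
    M.zMatrix θ (M.dualSLD θ) = (M.partialRLDFisher θ)⁻¹ := by
  refine sub_eq_zero.1 (eq_zero_of_forall_trace_mul_re_le
    (M.posSemidef_zMatrix_sub hθ (M.feasible_dualSLD hθ))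
    (M.posDef_partialRLDFisher hθ).inv.isHermitian fun W hW => ?_)
  obtain ⟨X, hX, hXW⟩ := (M.isLeast_holevoBound hθ hW).1
  rw [h W hW, rldBound] at hXW
  have h1 := M.trace_mul_zMatrix_dualSLD_re_le hθ hW.posSemidef hX
  have h2 := trace_mul_re_le_weightedBound W (M.zMatrix θ X)
  have h3 : (M.zMatrix θ (M.dualSLD θ) - (M.partialRLDFisher θ)⁻¹).map Complex.re
      = (M.zMatrix θ (M.dualSLD θ)).map Complex.re - (M.partialRLDFisher θ)⁻¹.map Complex.re := by
    ext i j
    simp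
  rw [h3, Matrix.mul_sub, Matrix.trace_sub]
  linarith

theorem dInvariantAt_iff (hθ : θ ∈ M.Θ) : M.DInvariantAt θ ↔
    ∀ W : Matrix (Fin dI) (Fin dI) ℝ, W.PosDef → M.holevoBound θ W = M.rldBound θ W :=
  ⟨fun h _ hW => M.holevoBound_eq_rldBound hθ (M.zMatrix_dualSLD_eq_of_dInvariantAt hθ h) hW,
    fun h => M.dInvariantAt_of_zMatrix_dualSLD_eq hθ (M.zMatrix_dualSLD_eq_of_holevoBound_eq hθ h)⟩

end Model

end Attainment

end QNuisance

theorem mainTheorem3 {n dI dN : ℕ} (M : QNuisance.Model n dI dN) :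
    (∀ θ ∈ M.Θ, ∀ W : Matrix (Fin dI) (Fin dI) ℝ, W.PosDef →
        IsLeast (M.holevoValues θ W) (M.holevoBound θ W)) ∧
      (∀ θ ∈ M.Θ, (M.DInvariantAt θ ↔
        ∀ W : Matrix (Fin dI) (Fin dI) ℝ, W.PosDef → M.holevoBound θ W = M.rldBound θ W)) ∧
      (M.DInvariant ↔
        ∀ θ ∈ M.Θ, ∀ W : Matrix (Fin dI) (Fin dI) ℝ, W.PosDef →
          M.holevoBound θ W = M.rldBound θ W) :=
  ⟨fun _ hθ _ hW => M.isLeast_holevoBound hθ hW, fun _ hθ => M.dInvariantAt_iff hθ,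
    forall₂_congr fun _ hθ => M.dInvariantAt_iff hθ⟩
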